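/- **Setting.** Let $V$ be a finite set and $\rho:V\times V\to[0,\infty)$ with $\rho(v,v)=0$ and $\rho(u,v)=\rho(v,u)$. Let $X_v$, $v\in V$, be centered real random variables on a probability space with finite moments of all orders, and for $v\in V$, $t\in(0,\infty]$ let $\varrho_{v,t}\in(0,\infty]$ satisfy $\|X_v\|_t\le\varrho_{v,t}$. Put $W=\sum_{v\in V}X_v$, and let $\Gamma_k(W)=i^{-k}\frac{d^k}{dt^k}\ln\mathbb E e^{itW}\big|_{t=0}$ be its $k$-th cumulant. Let $0<\delta\le\infty$ and let $\gamma_\delta(b,k)\ge0$ ($b>0$, $k\ge1$) be numbers such that the following mixing condition holds: for all $k\ge1$, $b>0$ and every nonempty finite collection $(A_j)_{j\in\mathcal J}$ of nonempty finite families of elements of $V$ (an element may occur several times in a family; cardinalities and products are taken with multiplicity) with $\rho(u,v)\ge b$ whenever $u\in A_i$, $v\in A_j$, $i\ne j$, and $r:=\sum_{j}|A_j|\le k$, $$\Big|\mathbb E\prod_{j\in\mathcal J}\prod_{i\in A_j}X_i-\prod_{j\in\mathcal J}\mathbb E\prod_{i\in A_j}X_i\Big|\le(r-1)\Big(\prod_{j\in\mathcal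 J}\prod_{i\in A_j}\varrho_{i,(1+\delta)k}\Big)\gamma_\delta(b,k).$$ Put $\tilde\gamma_\delta(m,k)=\max\{\gamma_\delta(m,r)/r:1\le r\le k\}$ and $M_q=\max\{\varrho_{v,q}:v\in V\}$, and write $M_q^k=(M_q)^k$. **Statement.** There is an absolute constant $C>0$ such that for all $c_0\ge1$, $a>0$, $u_0\ge0$, $\eta>0$ there is a constant $c>0$ depending only on $c_0,a,u_0,\eta$ with the following property. Suppose that, in the above setting, $$|\{u\in V:\rho(u,v)\le s\}|\le c_0s^{u_0}\quad(v\in V,\ s\ge1),\qquad \tilde\gamma_\delta(m,k)\le d\,e^{-am^\eta}\quad(k,m\in\mathbb N,\ k,m\ge1)$$ for some $d\ge1$. Then: 1. For every $k\ge2$, $\ |\Gamma_k(W)|\le d^k|V|c^k(k!)^{1+u_0/\eta}\big(M_k^k+M_{(1+\delta)k}^k\big).$ 2. If the $X_v$ are bounded and $\delta=\infty$, then all assumptions of the setting remain true with $\varrho_{v,\infty}$ in place of $\varrho_{v,t}$ for every $t>0$, and for every $k\ge2$, $\ |\Gamma_k(W)|\le2d^k|V|M_\infty^kc^k(k!)^{1+u_0/\eta}.$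 3. If $\delta<\infty$ and there are $\theta\ge0$, $M>0$ with $(\varrho_{v,q})^q\le M^q(q!)^\theta$ for all $v\in V$ and all $q$ of the form $q=j$ or $q=(1+\delta)j$, $j=1,2,\dots$ (where $q!:=\Gamma(q+1)$ is given by Euler's Gamma function), then for every $k\ge2$, $$|\Gamma_k(W)|\le3C^{\frac{\theta}{1+\delta}}d^k|V|c^k(1+\delta)^{\theta k}M^k(k!)^{1+\frac{u_0}\eta+\theta}.$$ -/

import Mathlib

open MeasureTheory
open scoped ENNReal NNReal

/-- The `k`-th cumulant `i⁻ᵏ (dᵏ/dtᵏ) ln 𝔼 exp(itW)` at `t = 0` of a random variable `W`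
(the principal logarithm is the relevant branch near `t = 0`, where the characteristic function
is close to `1`). -/
noncomputable def cumulant {Ω : Type*} [MeasurableSpace Ω] (P : Measure Ω) (W : Ω → ℝ) (k : ℕ) : ℂ :=
  (Complex.I ^ k)⁻¹ * iteratedDeriv k (fun t : ℝ => Complex.log (charFun (P.map W) t)) 0

/-- The setting of the cumulant estimates: a symmetric function `ρ ≥ 0` on a finite set `V` which
vanishes on the diagonal, centered random variables `X v` with finite moments of all orders,
upper bounds `ϱ v t ∈ (0, ∞]` of the norms `‖X v‖_t`, `t ∈ (0, ∞]`, and the mixing condition with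
parameters `δ ∈ (0, ∞]` and `γ b k = γ_δ(b, k) ≥ 0`. The index families `A j` in the mixing condition
are finite and nonempty, and an element of `V` may occur in a family several times. -/
structure IsMixingField {V Ω : Type*} [MeasurableSpace Ω] (P : Measure Ω)
    (ρ : V → V → ℝ) (X : V → Ω → ℝ) (ϱ : V → ℝ≥0∞ → ℝ≥0∞) (δ : ℝ≥0∞) (γ : ℝ → ℕ → ℝ≥0) : Prop where
  rho_nonneg : ∀ u v, 0 ≤ ρ u v
  rho_self : ∀ v, ρ v v = 0
  rho_symm : ∀ u v, ρ u v = ρ v u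
  memLp : ∀ (v : V) (p : ℕ), MemLp (X v) p P
  centered : ∀ v, ∫ ω, X v ω ∂P = 0
  bound_pos : ∀ (v : V) (t : ℝ≥0∞), 0 < t → 0 < ϱ v t
  norm_le : ∀ (v : V) (t : ℝ≥0∞), 0 < t → eLpNorm (X v) t P ≤ ϱ v t
  delta_pos : 0 < δ
  mixing : ∀ (k : ℕ) (b : ℝ) (n : ℕ) (A : Fin n → Multiset V), 1 ≤ k → 0 < b → 1 ≤ n →
    (∀ j, A j ≠ 0) →
    (∀ i j, i ≠ j → ∀ u ∈ A i, ∀ v ∈ A j, b ≤ ρ u v) →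
    ∑ j, (A j).card ≤ k →
    ENNReal.ofReal |(∫ ω, ∏ j, ((A j).map fun v => X v ω).prod ∂P) -
        ∏ j, ∫ ω, ((A j).map fun v => X v ω).prod ∂P| ≤
      (((∑ j, (A j).card) - 1 : ℕ) : ℝ≥0∞) *
        (∏ j, ((A j).map fun v => ϱ v ((1 + δ) * k)).prod) * γ b k

/-- `γ̃(m, k) = max {γ(m, r) / r : 1 ≤ r ≤ k}`. -/
noncomputable def gammaTilde (γ : ℝ → ℕ → ℝ≥0) (m k : ℕ) : ℝ≥0 :=
  (Finset.Icc 1 k).sup fun r => γ m r / r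

/-- `M_q = max {ϱ v q : v ∈ V}`. -/
noncomputable def maxBound {V : Type*} [Fintype V] (ϱ : V → ℝ≥0∞ → ℝ≥0∞) (q : ℝ≥0∞) : ℝ≥0∞ :=
  Finset.univ.sup fun v => ϱ v q

/-!
The cumulant of order `k` of `W = ∑ v, X v` is the sum, over all `k`-tuples of points, of the
joint cumulants of the variables at these points (`sumOver_pinned_mixedMoment`). Two factors `k!`
threaten: a joint cumulant is a sum of that order over set partitions, and the tuples whose points
are linked by short steps are of that order in number. Only one `k!` is allowed, apart from the
factor `(k!) ^ (u₀ / η)` which the size of a ball of radius `k ^ (1 / η)` contributes. So the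
estimate of a joint cumulant has to take account of the geometry of its tuple.

This is done by an expansion in the style of Kirkwood and Salsburg. For disjoint index sets `A`
and `B` let `pinned μ A B` be the coefficients of `∂_A Z / Z`, where `Z` is the square-free
generating function of the mixed moments `μ`; for a single pinned index they are joint cumulants.
Each moment `μ (A ∪ B)` is expanded over the *isolated* sets `D ⊆ B`, which are connected to `A`
at some scale `h` and farther than `h` from all other points; the coefficients `cluster μ r A D`
are at most `2 ^ card D` times the mixing error at distance `h` (`abs_cluster_le`). That all
remaining points avoid the neighbourhood of `D` is expressed by inclusion-exclusion, and this
gives the recursion `pinned_eq_sum_cluster`: it contains no factorials, and it connects each new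
point to an old one at a distance at most `h`.

Hence a joint cumulant is bounded by a sum over trees. The mixing error `ε h` is at most `1`, so
it is bounded by the product of `ε h ^ (1 / k)` over the edges that belong to the cluster, and
thus by the product of the weights `ε (ρ u v) ^ (1 / k)` of these edges. The sum over all tuples
can be carried out edge by edge: it is at most `card V` times the number of trees, which is of
order `k!`, times `K ^ (k - 1)` (`sumOver_abs_pinned_le`), where `K` is the largest total weight
of the edges at a point and `K ≤ c * (k ^ 2 * d) ^ (1 / k) * k ^ (u₀ / η)`
(`exists_sum_exp_floor_le`). This is the general estimate (`exists_norm_cumulant_le`). The bounded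
case is the general one with constant bounds, and the case of growing moments follows from
`Γ(x k + 1) ≤ C x ^ (x k) (k!) ^ x` (`Gamma_mul_add_one_le`).
-/

namespace MixingCumulant

/-! ### Pinned coefficients and the cluster expansion -/

section

variable {ι : Type*} [DecidableEq ι]

/-- The coefficients of `∂_A Z / Z`, where `Z = ∑ μ(B) t^B` is the square-free generating function
of `μ`: they are defined by `∑_{B' ⊆ B} pinned μ A B' * μ (B \ B') = μ (A ∪ B)`. If `μ B` is the
mixed moment of random variables indexed by `B`, then `pinned μ {i} B` is, for `i ∉ B`, the joint
cumulant of the variables indexed by `insert i B`. -/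
noncomputable def pinned (μ : Finset ι → ℝ) (A B : Finset ι) : ℝ :=
  μ (A ∪ B) - ∑ B' : B.ssubsets, pinned μ A B'.1 * μ (B \ B'.1)
termination_by B.card
decreasing_by exact Finset.card_lt_card (Finset.mem_ssubsets.1 B'.2)

/-- Every point of `D` can be reached from `A` inside `A ∪ D` by steps of length at most `s`,
expressed without paths: no nonempty part of `D` is at distance more than `s` from the rest of
`A ∪ D`. -/
def Conn (r : ι → ι → ℕ) (s : ℕ) (A D : Finset ι) : Prop :=
  ∀ S ⊆ D, S.Nonempty → ∃ y ∈ S, ∃ x ∈ A ∪ (D \ S), r x y ≤ s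

/-- The least scale at which `D` is connected to `A`. It is meaningful when `A` is nonempty, so
that such a scale exists. -/
noncomputable def height (r : ι → ι → ℕ) (A D : Finset ι) : ℕ :=
  sInf {s | Conn r s A D}

/-- `D` is a cluster of `A` inside `A ∪ B`: the points of `B` outside `D` are farther from `A ∪ D`
than the scale which connects `D` to `A`. -/
def Isolated (r : ι → ι → ℕ) (A B D : Finset ι) : Prop :=
  ∀ y ∈ B \ D, ∀ x ∈ A ∪ D, height r A D < r x y

open Classical in
/-- The contribution of the cluster `B` of `A`, defined by the expansion
`μ (A ∪ B) = ∑ cluster μ r A D * μ (B \ D)` over the isolated sets `D ⊆ B`, of which `B` itself is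
one. -/
noncomputable def cluster (μ : Finset ι → ℝ) (r : ι → ι → ℕ) (A B : Finset ι) : ℝ :=
  μ (A ∪ B) - ∑ D : B.ssubsets, if Isolated r A B D.1 then cluster μ r A D.1 * μ (B \ D.1) else 0
termination_by B.card
decreasing_by exact Finset.card_lt_card (Finset.mem_ssubsets.1 D.2)

theorem sum_powerset_eq_add_ssubsets {R : Type*} [AddCommMonoid R] (f : Finset ι → R)
    (B : Finset ι) :
    ∑ D ∈ B.powerset, f D = f B + ∑ D ∈ B.ssubsets, f D := by
  rw [Finset.ssubsets, Finset.add_sum_erase _ _ (Finset.mem_powerset_self B)]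

theorem sum_pinned_mul {μ : Finset ι → ℝ} (h0 : μ ∅ = 1) (A B : Finset ι) :
    ∑ B' ∈ B.powerset, pinned μ A B' * μ (B \ B') = μ (A ∪ B) := by
  rw [sum_powerset_eq_add_ssubsets, pinned, Finset.sdiff_self, h0,
    ← Finset.sum_coe_sort B.ssubsets (fun B' => pinned μ A B' * μ (B \ B'))]
  ring

theorem eq_pinned_of_sum_mul {μ : Finset ι → ℝ} (h0 : μ ∅ = 1) {A : Finset ι} {f : Finset ι → ℝ}
    (hf : ∀ B, ∑ B' ∈ B.powerset, f B' * μ (B \ B') = μ (A ∪ B)) (B : Finset ι) :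
    f B = pinned μ A B := by
  induction B using Finset.strongInduction with
  | H B ih =>
    have h1 := hf B
    rw [← sum_pinned_mul h0 A B, sum_powerset_eq_add_ssubsets, sum_powerset_eq_add_ssubsets,
      Finset.sdiff_self, h0, Finset.sum_congr rfl fun D hD => by
        rw [ih D (Finset.mem_ssubsets.1 hD)]] at h1
    linarith

theorem pinned_empty {μ : Finset ι → ℝ} (h0 : μ ∅ = 1) (B : Finset ι) :
    pinned μ ∅ B = if B = ∅ then 1 else 0 := by
  symm
  refine eq_pinned_of_sum_mul h0 (f := fun B => if B = ∅ then 1 else 0) (fun B => ?_) B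
  rw [Finset.sum_eq_single ∅]
  · simp
  · intro b _ hb
    simp [hb]
  · simp

theorem pinned_congr {μ μ' : Finset ι → ℝ} {A B : Finset ι}
    (h : ∀ S ⊆ A ∪ B, μ S = μ' S) : pinned μ A B = pinned μ' A B := by
  induction B using Finset.strongInduction with
  | H B ih =>
    rw [pinned, pinned, h _ subset_rfl]
    congr 1
    refine Finset.sum_congr rfl fun D _ => ?_
    have hD := Finset.mem_ssubsets.1 D.2
    rw [ih D hD fun S hS => h S (hS.trans (Finset.union_subset_union_right hD.1)),
      h _ (Finset.sdiff_subset.trans Finset.subset_union_right)]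

open Classical in
theorem sum_cluster_mul {μ : Finset ι → ℝ} (h0 : μ ∅ = 1) (r : ι → ι → ℕ) (A B : Finset ι) :
    ∑ D ∈ B.powerset, (if Isolated r A B D then cluster μ r A D * μ (B \ D) else 0) =
      μ (A ∪ B) := by
  have hB : Isolated r A B B := by simp [Isolated]
  rw [sum_powerset_eq_add_ssubsets, if_pos hB, cluster, Finset.sdiff_self, h0,
    ← Finset.sum_coe_sort B.ssubsets
      (fun D => if Isolated r A B D then cluster μ r A D * μ (B \ D) else 0)]
  ring

open Classical in
/-- The points of `B \ D` which prevent `D` from being isolated in `B`. Whether a point belongs to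
this set depends on `A`, `D` and the point alone; this makes inclusion-exclusion over the set
possible. -/
noncomputable def nearby (r : ι → ι → ℕ) (A B D : Finset ι) : Finset ι :=
  (B \ D).filter fun y => ∃ x ∈ A ∪ D, r x y ≤ height r A D

theorem nearby_eq_empty_iff {r : ι → ι → ℕ} {A B D : Finset ι} :
    nearby r A B D = ∅ ↔ Isolated r A B D := by
  simp only [nearby, Finset.filter_eq_empty_iff, Isolated]
  push Not
  rfl

/-- Sums over the pairs `D ⊆ C ⊆ B`, parametrised by `D` and `C \ D`. -/
theorem sum_powerset_powerset (f : Finset ι → Finset ι → ℝ) (B : Finset ι) :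
    ∑ C ∈ B.powerset, ∑ D ∈ C.powerset, f C D =
      ∑ D ∈ B.powerset, ∑ E ∈ (B \ D).powerset, f (D ∪ E) D := by
  rw [Finset.sum_sigma', Finset.sum_sigma']
  refine Finset.sum_bij' (fun p _ => ⟨p.2, p.1 \ p.2⟩) (fun p _ => ⟨p.1 ∪ p.2, p.1⟩) ?_ ?_ ?_ ?_ ?_
  · rintro ⟨C, D⟩ h
    simp only [Finset.mem_sigma, Finset.mem_powerset] at h ⊢
    exact ⟨h.2.trans h.1, Finset.sdiff_subset_sdiff h.1 subset_rfl⟩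
  · rintro ⟨D, E⟩ h
    simp only [Finset.mem_sigma, Finset.mem_powerset] at h ⊢
    exact ⟨Finset.union_subset h.1 (h.2.trans Finset.sdiff_subset), Finset.subset_union_left⟩
  · rintro ⟨C, D⟩ h
    simp only [Finset.mem_sigma, Finset.mem_powerset] at h ⊢
    simp [Finset.union_sdiff_of_subset h.2]
  · rintro ⟨D, E⟩ h
    simp only [Finset.mem_sigma, Finset.mem_powerset] at h ⊢
    have : Disjoint D E := (Finset.sdiff_disjoint.mono_left h.2).symm
    simp [Finset.union_sdiff_cancel_left this]
  · rintro ⟨C, D⟩ h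
    simp only [Finset.mem_sigma, Finset.mem_powerset] at h ⊢
    simp [Finset.union_sdiff_of_subset h.2]

theorem nearby_union {r : ι → ι → ℕ} {A B D E : Finset ι} (hE : E ⊆ B \ D) :
    nearby r A (D ∪ E) D = nearby r A B D ∩ E := by
  ext y
  have := @hE y
  simp only [nearby, Finset.mem_filter, Finset.mem_inter, Finset.mem_sdiff, Finset.mem_union] at *
  generalize (∃ x, (x ∈ A ∨ x ∈ D) ∧ r x y ≤ height r A D) = p
  tauto

open Classical in
/-- A recursion of Kirkwood-Salsburg type. The cluster expansion of `μ (A ∪ B)` is divided by the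
generating function `Z`; the constraint that the rest of `B` avoids the points near `D` is removed
by inclusion-exclusion, and the excluded points `Y` become the new pinned set. -/
theorem pinned_eq_sum_cluster {μ : Finset ι → ℝ} (h0 : μ ∅ = 1) (r : ι → ι → ℕ)
    (A B : Finset ι) :
    pinned μ A B = ∑ D ∈ B.powerset, cluster μ r A D *
      ∑ Y ∈ (nearby r A B D).powerset, (-1 : ℝ) ^ Y.card * pinned μ Y ((B \ D) \ Y) := by
  symm
  refine eq_pinned_of_sum_mul h0 (f := fun B => ∑ D ∈ B.powerset, cluster μ r A D *
      ∑ Y ∈ (nearby r A B D).powerset, (-1 : ℝ) ^ Y.card * pinned μ Y ((B \ D) \ Y)) (fun B => ?_) B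
  simp only [Finset.sum_mul]
  rw [sum_powerset_powerset (fun C D => cluster μ r A D *
      (∑ Y ∈ (nearby r A C D).powerset, (-1 : ℝ) ^ Y.card * pinned μ Y ((C \ D) \ Y)) *
        μ (B \ C)), ← sum_cluster_mul h0 r A B]
  refine Finset.sum_congr rfl fun D hD => ?_
  rw [Finset.mem_powerset] at hD
  have key : ∑ E ∈ (B \ D).powerset,
      (∑ Y ∈ (nearby r A (D ∪ E) D).powerset,
        (-1 : ℝ) ^ Y.card * pinned μ Y (((D ∪ E) \ D) \ Y)) * μ (B \ (D ∪ E)) =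
      if Isolated r A B D then μ (B \ D) else 0 := by
    have h1 : ∀ E ∈ (B \ D).powerset,
        (∑ Y ∈ (nearby r A (D ∪ E) D).powerset,
          (-1 : ℝ) ^ Y.card * pinned μ Y (((D ∪ E) \ D) \ Y)) * μ (B \ (D ∪ E)) =
        ∑ Y ∈ E.powerset, if Y ⊆ nearby r A B D then
          (-1 : ℝ) ^ Y.card * pinned μ Y (E \ Y) * μ ((B \ D) \ E) else 0 := by
      intro E hE
      rw [Finset.mem_powerset] at hE
      have hDE : Disjoint D E := (Finset.sdiff_disjoint.mono_left hE).symm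
      rw [nearby_union hE, Finset.sum_mul, ← Finset.sum_filter]
      have : (nearby r A B D ∩ E).powerset = E.powerset.filter (· ⊆ nearby r A B D) := by
        ext Y
        simp only [Finset.mem_powerset, Finset.mem_filter, Finset.subset_inter_iff]
        tauto
      rw [this]
      refine Finset.sum_congr rfl fun Y _ => ?_
      rw [Finset.union_sdiff_cancel_left hDE, sdiff_sdiff_left, Finset.sup_eq_union]
    rw [Finset.sum_congr rfl h1, sum_powerset_powerset (fun E Y => if Y ⊆ nearby r A B D then
          (-1 : ℝ) ^ Y.card * pinned μ Y (E \ Y) * μ ((B \ D) \ E) else 0)]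
    have h2 : ∀ Y ∈ (B \ D).powerset,
        (∑ E ∈ ((B \ D) \ Y).powerset, if Y ⊆ nearby r A B D then
          (-1 : ℝ) ^ Y.card * pinned μ Y ((Y ∪ E) \ Y) * μ ((B \ D) \ (Y ∪ E)) else 0) =
        if Y ⊆ nearby r A B D then (-1 : ℝ) ^ Y.card * μ (B \ D) else 0 := by
      intro Y hY
      rw [Finset.mem_powerset] at hY
      split_ifs with hN
      · have h3 := sum_pinned_mul h0 Y ((B \ D) \ Y)
        rw [Finset.union_sdiff_of_subset hY] at h3
        rw [← h3, Finset.mul_sum]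
        refine Finset.sum_congr rfl fun E hE => ?_
        rw [Finset.mem_powerset] at hE
        have hYE : Disjoint Y E := (Finset.sdiff_disjoint.mono_left hE).symm
        rw [Finset.union_sdiff_cancel_left hYE, ← Finset.sup_eq_union,
          ← sdiff_sdiff_left, mul_assoc]
      · simp
    rw [Finset.sum_congr rfl h2, ← Finset.sum_filter]
    have : (B \ D).powerset.filter (· ⊆ nearby r A B D) = (nearby r A B D).powerset := by
      ext Y
      simp only [Finset.mem_powerset, Finset.mem_filter, and_iff_right_iff_imp]
      exact fun h => h.trans (Finset.filter_subset _ _)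
    rw [this, ← Finset.sum_mul]
    have h4 := Finset.sum_powerset_neg_one_pow_card (x := nearby r A B D)
    have h5 : ∑ Y ∈ (nearby r A B D).powerset, (-1 : ℝ) ^ Y.card =
        if nearby r A B D = ∅ then 1 else 0 := by
      exact_mod_cast congrArg (Int.cast : ℤ → ℝ) h4
    rw [h5]
    simp only [nearby_eq_empty_iff]
    split_ifs <;> simp
  simp only [mul_assoc, ← Finset.mul_sum]
  rw [key]
  split_ifs <;> simp

end

/-! ### Estimates for clusters -/

section

variable {ι : Type*} [DecidableEq ι]

theorem exists_conn (r : ι → ι → ℕ) {A : Finset ι} (hA : A.Nonempty) (D : Finset ι) :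
    ∃ s, Conn r s A D := by
  obtain ⟨a, ha⟩ := hA
  refine ⟨D.sup (r a), fun S hS hne => ?_⟩
  obtain ⟨y, hy⟩ := hne
  exact ⟨y, hy, a, Finset.mem_union_left _ ha, Finset.le_sup (f := r a) (hS hy)⟩

theorem conn_height (r : ι → ι → ℕ) {A : Finset ι} (hA : A.Nonempty) (D : Finset ι) :
    Conn r (height r A D) A D :=
  Nat.sInf_mem (exists_conn r hA D)

/-- The largest subset of `B` that is connected to `A` at scale `s`. -/
theorem exists_component (r : ι → ι → ℕ) (s : ℕ) (A B : Finset ι) :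
    ∃ D ⊆ B, Conn r s A D ∧ ∀ y ∈ B \ D, ∀ x ∈ A ∪ D, s < r x y := by
  classical
  have hne : (B.powerset.filter fun D => Conn r s A D).Nonempty :=
    ⟨∅, by
      simp only [Finset.mem_filter, Finset.mem_powerset, Finset.empty_subset, true_and]
      intro S hS hne
      exact absurd (Finset.subset_empty.1 hS) hne.ne_empty⟩
  obtain ⟨D, hD, hmax⟩ := Finset.exists_max_image _ Finset.card hne
  simp only [Finset.mem_filter, Finset.mem_powerset] at hD hmax
  refine ⟨D, hD.1, hD.2, fun y hy x hx => ?_⟩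
  by_contra hlt
  rw [Finset.mem_sdiff] at hy
  have hc : Conn r s A (insert y D) := by
    intro S hS hne
    by_cases hSD : (S ∩ D).Nonempty
    · obtain ⟨z, hz, x, hx, hxy⟩ := hD.2 (S ∩ D) Finset.inter_subset_right hSD
      refine ⟨z, (Finset.mem_inter.1 hz).1, x, ?_, hxy⟩
      simp only [Finset.mem_union, Finset.mem_sdiff, Finset.mem_inter, Finset.mem_insert] at hx ⊢
      tauto
    · have hSy : ∀ z ∈ S, z = y := by
        intro z hz
        rcases Finset.mem_insert.1 (hS hz) with h | h
        · exact h
        · exact absurd ⟨z, Finset.mem_inter.2 ⟨hz, h⟩⟩ hSD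
      obtain ⟨z, hz⟩ := hne
      obtain rfl := hSy z hz
      refine ⟨z, hz, x, ?_, not_lt.1 hlt⟩
      have hxS : x ∈ D → x ∉ S := fun h h' => hSD ⟨x, Finset.mem_inter.2 ⟨h', h⟩⟩
      simp only [Finset.mem_union, Finset.mem_sdiff, Finset.mem_insert] at hx ⊢
      tauto
  have := hmax (insert y D) ⟨Finset.insert_subset hy.1 hD.1, hc⟩
  rw [Finset.card_insert_of_notMem hy.2] at this
  omega

/-- A set connected to `A` at scale `s` cannot leave a set `E` from which everything else is
farther away than `s`. -/
theorem subset_of_conn_of_separated {r : ι → ι → ℕ} {s t : ℕ} (hst : s ≤ t) {A B D E : Finset ι}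
    (hDB : D ⊆ B) (hD : Conn r s A D) (hE : ∀ y ∈ B \ E, ∀ x ∈ A ∪ E, t < r x y) : D ⊆ E := by
  by_contra hne
  obtain ⟨z, hz⟩ := Finset.sdiff_nonempty.2 hne
  obtain ⟨y, hy, x, hx, hxy⟩ := hD (D \ E) Finset.sdiff_subset ⟨z, hz⟩
  rw [Finset.mem_sdiff] at hy
  have h1 := hE y (Finset.mem_sdiff.2 ⟨hDB hy.1, hy.2⟩) x (by
    simp only [Finset.mem_union, Finset.mem_sdiff] at hx ⊢
    tauto)
  omega

/-- The isolated subsets of `B` form a chain. -/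
theorem Isolated.subset_or_subset {r : ι → ι → ℕ} {A B D E : Finset ι} (hA : A.Nonempty)
    (hDB : D ⊆ B) (hEB : E ⊆ B) (hD : Isolated r A B D) (hE : Isolated r A B E) :
    D ⊆ E ∨ E ⊆ D := by
  rcases le_total (height r A D) (height r A E) with h | h
  · exact Or.inl (subset_of_conn_of_separated h hDB (conn_height r hA D) hE)
  · exact Or.inr (subset_of_conn_of_separated h hEB (conn_height r hA E) hD)

/-- Isolated sets are nested, hence have distinct cardinalities; this replaces the number of all
subsets by a geometric series. -/
theorem sum_two_pow_card_isolated_le {r : ι → ι → ℕ} {A B : Finset ι} (hA : A.Nonempty)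
    (T : Finset (Finset ι)) {n : ℕ} (hT : ∀ D ∈ T, D ⊆ B ∧ Isolated r A B D ∧ D.card < n) :
    1 + ∑ D ∈ T, (2 : ℝ) ^ D.card ≤ 2 ^ n := by
  have hinj : Set.InjOn Finset.card (T : Set (Finset ι)) := by
    intro D hD E hE hc
    obtain ⟨h1, h2, _⟩ := hT D hD
    obtain ⟨h3, h4, _⟩ := hT E hE
    rcases Isolated.subset_or_subset hA h1 h3 h2 h4 with h | h
    · exact Finset.eq_of_subset_of_card_le h hc.ge
    · exact (Finset.eq_of_subset_of_card_le h hc.le).symm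
  have h1 : ∑ D ∈ T, (2 : ℝ) ^ D.card = ∑ j ∈ T.image Finset.card, (2 : ℝ) ^ j :=
    (Finset.sum_image hinj).symm
  have h2 : ∑ j ∈ T.image Finset.card, (2 : ℝ) ^ j ≤ ∑ j ∈ Finset.range n, (2 : ℝ) ^ j := by
    refine Finset.sum_le_sum_of_subset_of_nonneg ?_ fun _ _ _ => by positivity
    intro j hj
    obtain ⟨D, hD, rfl⟩ := Finset.mem_image.1 hj
    exact Finset.mem_range.2 (hT D hD).2.2
  have h3 := geom_sum_eq (x := (2 : ℝ)) (by norm_num) n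
  rw [h1]
  rw [h3] at h2
  norm_num at h2
  linarith

/-- Moments `μ`, normalised to be at most `1`, which factorise up to the error `ε h` over two sets
at distance at least `h`, as long as at most `k` points are involved. -/
structure WeakFactor (μ : Finset ι → ℝ) (r : ι → ι → ℕ) (ε : ℕ → ℝ) (k : ℕ) : Prop where
  empty : μ ∅ = 1
  abs_le : ∀ B, B.card ≤ k → |μ B| ≤ 1
  eps_zero : ε 0 = 1
  eps_le : ∀ h, ε h ≤ 1
  eps_nonneg : ∀ h, 0 ≤ ε h
  sub_le : ∀ (h : ℕ) (C D : Finset ι), 1 ≤ h → Disjoint C D → (C ∪ D).card ≤ k →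
    (∀ x ∈ C, ∀ y ∈ D, h ≤ r x y) → |μ (C ∪ D) - μ C * μ D| ≤ ε h

/-- Clusters are small. Let `E` be the part of `B` connected to `A` at the scale just below the
height of `B`. All isolated proper subsets of `B` lie in `E`, and factorising every moment over
`E` and `B \ E` would give zero; so only the factorisation errors remain, one for each isolated
set. -/
theorem abs_cluster_le {μ : Finset ι → ℝ} {r : ι → ι → ℕ} {ε : ℕ → ℝ} {k : ℕ}
    (H : WeakFactor μ r ε k) {A : Finset ι} (hA : A.Nonempty) (B : Finset ι) (hAB : Disjoint A B)
    (hk : (A ∪ B).card ≤ k) :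
    |cluster μ r A B| ≤ 2 ^ B.card * ε (height r A B) := by
  classical
  induction B using Finset.strongInduction with
  | H B ih =>
  have hmain := sum_cluster_mul H.empty r A B
  have hBB : Isolated r A B B := by simp [Isolated]
  have hcard : ∀ C ⊆ A ∪ B, C.card ≤ k := fun C hC => (Finset.card_le_card hC).trans hk
  rw [sum_powerset_eq_add_ssubsets, if_pos hBB, Finset.sdiff_self, H.empty, mul_one] at hmain
  rcases Nat.eq_zero_or_pos (height r A B) with h0 | hpos
  · have hz : ∑ D ∈ B.ssubsets,
        (if Isolated r A B D then cluster μ r A D * μ (B \ D) else 0) = 0 := by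
      refine Finset.sum_eq_zero fun D hD => if_neg fun hiso => ?_
      rw [Finset.mem_ssubsets] at hD
      have hc := conn_height r hA B
      rw [h0] at hc
      obtain ⟨z, hz⟩ := Finset.sdiff_nonempty.2 hD.2
      obtain ⟨y, hy, x, hx, hxy⟩ := hc (B \ D) Finset.sdiff_subset ⟨z, hz⟩
      have := hiso y hy x (by rwa [Finset.sdiff_sdiff_eq_self hD.1] at hx)
      omega
    rw [hz, add_zero] at hmain
    rw [hmain, h0, H.eps_zero, mul_one]
    exact (H.abs_le _ hk).trans (one_le_pow₀ (by norm_num))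
  · obtain ⟨E, hEB, hEc, hEs⟩ := exists_component r (height r A B - 1) A B
    have hEh : height r A E ≤ height r A B - 1 := Nat.sInf_le hEc
    have hEB' : E ⊂ B := by
      refine hEB.ssubset_of_ne ?_
      rintro rfl
      omega
    have hEi : Isolated r A B E := fun y hy x hx => lt_of_le_of_lt hEh (hEs y hy x hx)
    -- every isolated proper subset of `B` lies in `E`
    have hsub : ∀ D, D ⊂ B → Isolated r A B D → D ⊆ E := by
      intro D hD hiso
      refine subset_of_conn_of_separated ?_ hD.1 (conn_height r hA D) hEs
      have hc := conn_height r hA B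
      obtain ⟨z, hz⟩ := Finset.sdiff_nonempty.2 hD.2
      obtain ⟨y, hy, x, hx, hxy⟩ := hc (B \ D) Finset.sdiff_subset ⟨z, hz⟩
      have := hiso y hy x (by rwa [Finset.sdiff_sdiff_eq_self hD.1] at hx)
      omega
    -- for subsets of `E`, being isolated in `E` and in `B` is the same
    have hiff : ∀ D ⊆ E, (Isolated r A E D ↔ Isolated r A B D) := by
      intro D hDE
      refine ⟨fun h y hy x hx => ?_, fun h y hy x hx => ?_⟩
      · by_cases hyE : y ∈ E
        · exact h y (Finset.mem_sdiff.2 ⟨hyE, (Finset.mem_sdiff.1 hy).2⟩) x hx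
        · have h1 := hEs y (Finset.mem_sdiff.2 ⟨(Finset.mem_sdiff.1 hy).1, hyE⟩) x
            (Finset.union_subset_union_right hDE hx)
          rcases eq_or_ne D E with rfl | hne
          · omega
          · have hss := hDE.ssubset_of_ne hne
            have hc := hEc
            obtain ⟨z, hz⟩ := Finset.sdiff_nonempty.2 hss.2
            obtain ⟨y', hy', x', hx', hxy⟩ := hc (E \ D) Finset.sdiff_subset ⟨z, hz⟩
            have := h y' hy' x' (by rwa [Finset.sdiff_sdiff_eq_self hDE] at hx')
            omega
      · exact h y (Finset.sdiff_subset_sdiff hEB subset_rfl hy) x hx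
    have hE := sum_cluster_mul H.empty r A E
    have hsum : ∑ D ∈ B.ssubsets,
        (if Isolated r A B D then cluster μ r A D * μ (B \ D) else 0) =
        ∑ D ∈ E.powerset, (if Isolated r A B D then cluster μ r A D * μ (B \ D) else 0) := by
      symm
      refine Finset.sum_subset ?_ ?_
      · intro D hD
        rw [Finset.mem_powerset] at hD
        exact Finset.mem_ssubsets.2 (lt_of_le_of_lt hD hEB')
      · intro D hD hnD
        rw [Finset.mem_ssubsets] at hD
        exact if_neg fun hi => hnD (Finset.mem_powerset.2 (hsub D hD hi))
    have hE' : ∑ D ∈ E.powerset, (if Isolated r A B D then cluster μ r A D * μ (E \ D) else 0) =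
        μ (A ∪ E) := by
      rw [← hE]
      refine Finset.sum_congr rfl fun D hD => ?_
      simp only [hiff D (Finset.mem_powerset.1 hD)]
    have hid : cluster μ r A B = (μ (A ∪ B) - μ (A ∪ E) * μ (B \ E)) +
        ∑ D ∈ E.ssubsets, (if Isolated r A B D then
          cluster μ r A D * (μ (E \ D) * μ (B \ E) - μ (B \ D)) else 0) := by
      have h1 : cluster μ r A B = μ (A ∪ B) -
          ∑ D ∈ E.powerset, (if Isolated r A B D then cluster μ r A D * μ (B \ D) else 0) := by
        rw [← hsum]; linarith
      have h2 : ∑ D ∈ E.powerset, (if Isolated r A B D then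
          cluster μ r A D * (μ (E \ D) * μ (B \ E) - μ (B \ D)) else 0) =
          μ (A ∪ E) * μ (B \ E) -
          ∑ D ∈ E.powerset, (if Isolated r A B D then cluster μ r A D * μ (B \ D) else 0) := by
        rw [← hE', Finset.sum_mul, ← Finset.sum_sub_distrib]
        refine Finset.sum_congr rfl fun D _ => ?_
        split_ifs <;> ring
      rw [sum_powerset_eq_add_ssubsets, if_pos hEi, Finset.sdiff_self, H.empty] at h2
      linarith
    have hsep : ∀ y ∈ B \ E, ∀ x ∈ A ∪ E, height r A B ≤ r x y := fun y hy x hx => by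
      have := hEs y hy x hx
      omega
    have e1 : |μ (A ∪ B) - μ (A ∪ E) * μ (B \ E)| ≤ ε (height r A B) := by
      have h2 : A ∪ B = (A ∪ E) ∪ (B \ E) := by
        rw [Finset.union_assoc, Finset.union_sdiff_of_subset hEB]
      have h3 := H.sub_le (height r A B) (A ∪ E) (B \ E) hpos
        (Finset.disjoint_union_left.2
          ⟨hAB.mono_right Finset.sdiff_subset, Finset.disjoint_sdiff⟩)
        (h2 ▸ hk) (fun x hx y hy => hsep y hy x hx)
      rwa [← h2] at h3
    have e2 : ∀ D ∈ E.ssubsets, |if Isolated r A B D then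
          cluster μ r A D * (μ (E \ D) * μ (B \ E) - μ (B \ D)) else 0| ≤
        if Isolated r A B D then 2 ^ D.card * ε (height r A B) else 0 := by
      intro D hD
      rw [Finset.mem_ssubsets] at hD
      split_ifs with hi
      · have hDB : D ⊂ B := hD.trans_subset hEB
        have h1 := ih D hDB (hAB.mono_right hDB.1)
          (hcard _ (Finset.union_subset_union_right hDB.1))
        have h2 : B \ D = (E \ D) ∪ (B \ E) := by
          ext z
          have := @hEB z
          have := @hD.1 z
          simp only [Finset.mem_union, Finset.mem_sdiff]
          tauto
        have h3 := H.sub_le (height r A B) (E \ D) (B \ E) hpos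
          (Finset.disjoint_sdiff.mono_left Finset.sdiff_subset)
          (h2 ▸ hcard _ (Finset.sdiff_subset.trans Finset.subset_union_right))
          (fun x hx y hy => hsep y hy x
            (Finset.mem_union_right _ (Finset.sdiff_subset hx)))
        rw [← h2, abs_sub_comm] at h3
        rw [abs_mul]
        refine mul_le_mul (h1.trans ?_) h3 (abs_nonneg _) (by positivity)
        exact mul_le_of_le_one_right (by positivity) (H.eps_le _)
      · simp
    rw [hid]
    calc _ ≤ ε (height r A B) +
          ∑ D ∈ E.ssubsets, (if Isolated r A B D then 2 ^ D.card * ε (height r A B) else 0) :=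
          (abs_add_le _ _).trans (add_le_add e1
            ((Finset.abs_sum_le_sum_abs _ _).trans (Finset.sum_le_sum e2)))
      _ = (1 + ∑ D ∈ E.ssubsets.filter (Isolated r A B), (2 : ℝ) ^ D.card) *
          ε (height r A B) := by
          rw [← Finset.sum_filter, ← Finset.sum_mul]; ring
      _ ≤ 2 ^ B.card * ε (height r A B) := by
          refine mul_le_mul_of_nonneg_right ?_ (H.eps_nonneg _)
          refine sum_two_pow_card_isolated_le (r := r) (B := B) hA _ fun D hD => ?_
          rw [Finset.mem_filter, Finset.mem_ssubsets] at hD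
          exact ⟨(hD.1.trans_subset hEB).1, hD.2,
            Finset.card_lt_card (hD.1.trans_subset hEB)⟩

end

/-! ### Forest sums -/

section

variable {ι : Type*} [DecidableEq ι]

/-- The sum, over all forests on `A ∪ B` whose trees are rooted at the points of `A`, of the
products of the weights `g parent child`. The forests are enumerated by generations: `L` is the
set of children of the roots, and it is the root set of the remaining forest. -/
noncomputable def forestSum (g : ι → ι → ℝ) (A B : Finset ι) : ℝ :=
  if B = ∅ then 1 else
    ∑ L : (B.powerset.erase ∅ : Finset (Finset ι)),
      (∏ y ∈ L.1, ∑ x ∈ A, g x y) * forestSum g L.1 (B \ L.1)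
termination_by B.card
decreasing_by
  have h := Finset.mem_erase.1 L.2
  exact Finset.card_lt_card (Finset.sdiff_ssubset (Finset.mem_powerset.1 h.2)
    (Finset.nonempty_iff_ne_empty.2 h.1))

theorem forestSum_empty (g : ι → ι → ℝ) (A : Finset ι) : forestSum g A ∅ = 1 := by
  rw [forestSum, if_pos rfl]

theorem forestSum_of_nonempty (g : ι → ι → ℝ) (A : Finset ι) {B : Finset ι} (hB : B.Nonempty) :
    forestSum g A B = ∑ L ∈ B.powerset.erase ∅,
      (∏ y ∈ L, ∑ x ∈ A, g x y) * forestSum g L (B \ L) := by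
  rw [forestSum, if_neg hB.ne_empty, ← Finset.sum_coe_sort (B.powerset.erase ∅)
    (fun L => (∏ y ∈ L, ∑ x ∈ A, g x y) * forestSum g L (B \ L))]

theorem forestSum_nonneg {g : ι → ι → ℝ} (hg : ∀ x y, 0 ≤ g x y) (A B : Finset ι) :
    0 ≤ forestSum g A B := by
  induction B using Finset.strongInduction generalizing A with
  | H B ih =>
  rcases B.eq_empty_or_nonempty with rfl | hB
  · rw [forestSum_empty]; exact zero_le_one
  · rw [forestSum_of_nonempty g A hB]
    refine Finset.sum_nonneg fun L hL => mul_nonneg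
      (Finset.prod_nonneg fun y _ => Finset.sum_nonneg fun x _ => hg x y) ?_
    have h := Finset.mem_erase.1 hL
    exact ih _ (Finset.sdiff_ssubset (Finset.mem_powerset.1 h.2)
      (Finset.nonempty_iff_ne_empty.2 h.1)) _

theorem forestSum_congr {g g' : ι → ι → ℝ} {A B : Finset ι}
    (h : ∀ x ∈ A ∪ B, ∀ y ∈ A ∪ B, g x y = g' x y) : forestSum g A B = forestSum g' A B := by
  induction B using Finset.strongInduction generalizing A with
  | H B ih =>
  rcases B.eq_empty_or_nonempty with rfl | hB
  · rw [forestSum_empty, forestSum_empty]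
  · rw [forestSum_of_nonempty g A hB, forestSum_of_nonempty g' A hB]
    refine Finset.sum_congr rfl fun L hL => ?_
    have hL := Finset.mem_erase.1 hL
    have hLB := Finset.mem_powerset.1 hL.2
    have h1 : L ∪ (B \ L) ⊆ A ∪ B := by
      rw [Finset.union_sdiff_of_subset hLB]; exact Finset.subset_union_right
    rw [ih _ (Finset.sdiff_ssubset hLB (Finset.nonempty_iff_ne_empty.2 hL.1))
      fun x hx y hy => h x (h1 hx) y (h1 hy)]
    congr 1
    exact Finset.prod_congr rfl fun y hy => Finset.sum_congr rfl fun x hx =>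
      h x (Finset.mem_union_left _ hx) y (Finset.mem_union_right _ (hLB hy))

omit [DecidableEq ι] in
theorem pow_card_le_prod_sum {g : ι → ι → ℝ} (hg : ∀ x y, 0 ≤ g x y) {q : ℝ} (hq : 0 ≤ q)
    {A L : Finset ι} (h : ∀ y ∈ L, ∃ x ∈ A, q ≤ g x y) :
    q ^ L.card ≤ ∏ y ∈ L, ∑ x ∈ A, g x y := by
  rw [← Finset.prod_const]
  refine Finset.prod_le_prod (fun _ _ => hq) fun y hy => ?_
  obtain ⟨x, hx, hxy⟩ := h y hy
  exact hxy.trans (Finset.single_le_sum (f := fun x => g x y) (fun x _ => hg x y) hx)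

theorem pow_card_le_forestSum {g : ι → ι → ℝ} (hg : ∀ x y, 0 ≤ g x y) {r : ι → ι → ℕ} {s : ℕ}
    {q : ℝ} (hq : 0 ≤ q) (hrg : ∀ x y, r x y ≤ s → q ≤ g x y) {A D : Finset ι}
    (h : Conn r s A D) : q ^ D.card ≤ forestSum g A D := by
  induction D using Finset.strongInduction generalizing A with
  | H D ih =>
  rcases D.eq_empty_or_nonempty with rfl | hD
  · rw [forestSum_empty]; simp
  · classical
    rw [forestSum_of_nonempty g A hD]
    -- the first generation: the points within distance `s` of `A`
    set L := D.filter fun y => ∃ x ∈ A, r x y ≤ s with hLdef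
    have hLD : L ⊆ D := Finset.filter_subset _ _
    have hLne : L.Nonempty := by
      obtain ⟨y, hy, x, hx, hxy⟩ := h D subset_rfl hD
      rw [Finset.sdiff_self, Finset.union_empty] at hx
      exact ⟨y, Finset.mem_filter.2 ⟨hy, x, hx, hxy⟩⟩
    have hc : Conn r s L (D \ L) := by
      intro S hS hne
      obtain ⟨y, hy, x, hx, hxy⟩ := h S (hS.trans Finset.sdiff_subset) hne
      refine ⟨y, hy, x, ?_, hxy⟩
      have hyL := Finset.mem_sdiff.1 (hS hy)
      rcases Finset.mem_union.1 hx with hxA | hxD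
      · exact absurd (Finset.mem_filter.2 ⟨hyL.1, x, hxA, hxy⟩) hyL.2
      · simp only [Finset.mem_union, Finset.mem_sdiff] at hxD ⊢
        tauto
    have h1 : q ^ L.card ≤ ∏ y ∈ L, ∑ x ∈ A, g x y := by
      refine pow_card_le_prod_sum hg hq fun y hy => ?_
      obtain ⟨x, hx, hxy⟩ := (Finset.mem_filter.1 hy).2
      exact ⟨x, hx, hrg x y hxy⟩
    have h2 := ih _ (Finset.sdiff_ssubset hLD hLne) hc
    have hcard : D.card = L.card + (D \ L).card := by
      rw [Finset.card_sdiff_of_subset hLD]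
      have := Finset.card_le_card hLD
      omega
    rw [hcard, pow_add]
    refine (mul_le_mul h1 h2 (by positivity) ((by positivity : 0 ≤ q ^ L.card).trans h1)).trans ?_
    refine Finset.single_le_sum
      (f := fun L => (∏ y ∈ L, ∑ x ∈ A, g x y) * forestSum g L (D \ L)) (fun L _ => ?_) ?_
    · exact mul_nonneg (Finset.prod_nonneg fun y _ => Finset.sum_nonneg fun x _ => hg x y)
        (forestSum_nonneg hg _ _)
    · exact Finset.mem_erase.2 ⟨hLne.ne_empty, Finset.mem_powerset.2 hLD⟩

/-- The recursion for `pinned` with all terms estimated by edge weights `e (r x y)`, where `e`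
plays the role of `ε ^ (1 / k)`. A cluster of height `h` costs `ε h`, and `ε h` is at most the
product of the weights of the at most `k` edges of length at most `h` which join the points of `D`
and `Y` to `A ∪ D`. -/
theorem abs_pinned_le {μ : Finset ι → ℝ} {r : ι → ι → ℕ} {ε e : ℕ → ℝ} {k : ℕ}
    (H : WeakFactor μ r ε k) (he0 : ∀ h, 0 ≤ e h) (he1 : ∀ h, e h ≤ 1) (hanti : Antitone e)
    (hpow : ∀ h, ε h ≤ e h ^ k) {A : Finset ι} (hA : A.Nonempty) {B : Finset ι}
    (hAB : Disjoint A B) (hk : (A ∪ B).card ≤ k) :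
    |pinned μ A B| ≤ ∑ D ∈ B.powerset, 2 ^ D.card * forestSum (fun x y => e (r x y)) A D *
      ∑ Y ∈ (B \ D).powerset, (∏ y ∈ Y, ∑ x ∈ A ∪ D, e (r x y)) *
        |pinned μ Y ((B \ D) \ Y)| := by
  have hg : ∀ x y, 0 ≤ e (r x y) := fun x y => he0 _
  rw [pinned_eq_sum_cluster H.empty r A B]
  refine (Finset.abs_sum_le_sum_abs _ _).trans (Finset.sum_le_sum fun D hD => ?_)
  rw [Finset.mem_powerset] at hD
  have hAD : A ∪ D ⊆ A ∪ B := Finset.union_subset_union_right hD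
  rw [abs_mul]
  have h1 := abs_cluster_le H hA D (hAB.mono_right hD) ((Finset.card_le_card hAD).trans hk)
  calc _ ≤ (2 ^ D.card * ε (height r A D)) *
        ∑ Y ∈ (nearby r A B D).powerset, |pinned μ Y ((B \ D) \ Y)| := by
        refine mul_le_mul h1 ?_ (abs_nonneg _)
          (mul_nonneg (by positivity) (H.eps_nonneg _))
        refine (Finset.abs_sum_le_sum_abs _ _).trans (le_of_eq ?_)
        refine Finset.sum_congr rfl fun Y _ => ?_
        rw [abs_mul, abs_pow, abs_neg, abs_one, one_pow, one_mul]
    _ ≤ ∑ Y ∈ (nearby r A B D).powerset, 2 ^ D.card * forestSum (fun x y => e (r x y)) A D *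
          ((∏ y ∈ Y, ∑ x ∈ A ∪ D, e (r x y)) * |pinned μ Y ((B \ D) \ Y)|) := by
        rw [Finset.mul_sum]
        refine Finset.sum_le_sum fun Y hY => ?_
        rw [Finset.mem_powerset] at hY
        rw [mul_assoc, mul_assoc]
        refine mul_le_mul_of_nonneg_left ?_ (by positivity)
        rw [← mul_assoc]
        refine mul_le_mul_of_nonneg_right ?_ (abs_nonneg _)
        have h2 : e (height r A D) ^ D.card ≤ forestSum (fun x y => e (r x y)) A D :=
          pow_card_le_forestSum hg (he0 _) (fun x y hxy => hanti hxy) (conn_height r hA D)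
        have h3 : e (height r A D) ^ Y.card ≤ ∏ y ∈ Y, ∑ x ∈ A ∪ D, e (r x y) := by
          refine pow_card_le_prod_sum hg (he0 _) fun y hy => ?_
          obtain ⟨x, hx, hxy⟩ := (Finset.mem_filter.1 (hY hy)).2
          exact ⟨x, hx, hanti hxy⟩
        have hYB : Y ⊆ B \ D := hY.trans (Finset.filter_subset _ _)
        have hcard : D.card + Y.card ≤ k := by
          rw [← Finset.card_union_of_disjoint (Finset.disjoint_sdiff.mono_right hYB)]
          refine (Finset.card_le_card ?_).trans hk
          exact Finset.union_subset (hD.trans Finset.subset_union_right)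
            ((hYB.trans Finset.sdiff_subset).trans Finset.subset_union_right)
        calc ε (height r A D) ≤ e (height r A D) ^ k := hpow _
          _ ≤ e (height r A D) ^ (D.card + Y.card) :=
              pow_le_pow_of_le_one (he0 _) (he1 _) hcard
          _ = e (height r A D) ^ D.card * e (height r A D) ^ Y.card := pow_add _ _ _
          _ ≤ _ := mul_le_mul h2 h3 (pow_nonneg (he0 _) _) (forestSum_nonneg hg _ _)
    _ ≤ _ := by
        rw [Finset.mul_sum]
        refine Finset.sum_le_sum_of_subset_of_nonneg
          (Finset.powerset_mono.2 (Finset.filter_subset _ _)) fun Y _ _ => ?_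
        exact mul_nonneg (mul_nonneg (by positivity) (forestSum_nonneg hg _ _))
          (mul_nonneg (Finset.prod_nonneg fun y _ => Finset.sum_nonneg fun x _ => hg x y)
            (abs_nonneg _))

end

/-! ### Summation over tuples -/

section

variable {ι : Type*} [DecidableEq ι] [Fintype ι] {V : Type*} [Fintype V]

/-- The sum of `f` over all tuples that agree with `v` outside `B`. -/
noncomputable def sumOver (B : Finset ι) (f : (ι → V) → ℝ) (v : ι → V) : ℝ :=
  ∑ w ∈ Fintype.piFinset (fun i => if i ∈ B then Finset.univ else {v i}), f w

theorem mem_sumOver_iff {B : Finset ι} {v w : ι → V} :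
    w ∈ Fintype.piFinset (fun i => if i ∈ B then Finset.univ else {v i}) ↔
      ∀ i ∉ B, w i = v i := by
  rw [Fintype.mem_piFinset]
  refine forall_congr' fun i => ?_
  by_cases hi : i ∈ B <;> simp [hi]

theorem sumOver_le_sumOver {B : Finset ι} {f h : (ι → V) → ℝ} {v : ι → V}
    (hfh : ∀ w, (∀ i ∉ B, w i = v i) → f w ≤ h w) : sumOver B f v ≤ sumOver B h v :=
  Finset.sum_le_sum fun w hw => hfh w (mem_sumOver_iff.1 hw)

theorem sumOver_congr {B : Finset ι} {f h : (ι → V) → ℝ} {v : ι → V}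
    (hfh : ∀ w, (∀ i ∉ B, w i = v i) → f w = h w) : sumOver B f v = sumOver B h v :=
  Finset.sum_congr rfl fun w hw => hfh w (mem_sumOver_iff.1 hw)

theorem sumOver_nonneg {B : Finset ι} {f : (ι → V) → ℝ} (hf : ∀ w, 0 ≤ f w) (v : ι → V) :
    0 ≤ sumOver B f v :=
  Finset.sum_nonneg fun w _ => hf w

theorem sumOver_sum {α : Type*} (s : Finset α) (B : Finset ι) (f : α → (ι → V) → ℝ) (v : ι → V) :
    sumOver B (fun w => ∑ a ∈ s, f a w) v = ∑ a ∈ s, sumOver B (f a) v :=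
  Finset.sum_comm

theorem sumOver_mul_const (B : Finset ι) (f : (ι → V) → ℝ) (c : ℝ) (v : ι → V) :
    sumOver B (fun w => f w * c) v = sumOver B f v * c :=
  (Finset.sum_mul _ _ _).symm

theorem sumOver_empty (f : (ι → V) → ℝ) (v : ι → V) : sumOver ∅ f v = f v := by
  simp [sumOver]

theorem sumOver_union {S T : Finset ι} (hST : Disjoint S T) (f : (ι → V) → ℝ) (v : ι → V) :
    sumOver (S ∪ T) f v = sumOver S (sumOver T f) v := by
  unfold sumOver
  rw [Finset.sum_comm' (s' := fun w' => {fun i => if i ∈ T then v i else w' i})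
    (t' := Fintype.piFinset (fun i => if i ∈ S ∪ T then Finset.univ else {v i}))]
  · simp
  · intro w w'
    rw [mem_sumOver_iff, mem_sumOver_iff, mem_sumOver_iff, Finset.mem_singleton, funext_iff]
    refine ⟨fun ⟨h1, h2⟩ => ⟨fun i => ?_, fun i hi => ?_⟩,
      fun ⟨h1, h2⟩ => ⟨fun i hi => ?_, fun i hi => ?_⟩⟩
    · split_ifs with h
      · exact h1 i fun hS => Finset.disjoint_left.1 hST hS h
      · exact (h2 i h).symm
    · rw [Finset.mem_union, not_or] at hi
      rw [h2 i hi.2, h1 i hi.1]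
    · rw [h1]
      split_ifs with h
      · rfl
      · exact h2 i (by simp [hi, h])
    · rw [h1, if_neg hi]

theorem sumOver_mul_of_indep {T : Finset ι} {f : (ι → V) → ℝ}
    (hf : ∀ w w', (∀ i ∉ T, w i = w' i) → f w = f w') (h : (ι → V) → ℝ) (v : ι → V) :
    sumOver T (fun w => f w * h w) v = f v * sumOver T h v := by
  unfold sumOver
  rw [Finset.mul_sum]
  exact Finset.sum_congr rfl fun w hw => by
    beta_reduce
    rw [hf w v (mem_sumOver_iff.1 hw)]

/-- If `f` does not depend on the coordinates in `T`, the sum of `f * h` can be bounded by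
bounding the sums over `T` and over `S` separately. -/
theorem sumOver_mul_le {S T : Finset ι} (hST : Disjoint S T) {f h : (ι → V) → ℝ}
    (hf0 : ∀ w, 0 ≤ f w) (hh0 : ∀ w, 0 ≤ h w)
    (hf : ∀ w w', (∀ i ∉ T, w i = w' i) → f w = f w') {b c : ℝ} {v : ι → V}
    (hb : ∀ w, sumOver T h w ≤ b) (hc : sumOver S f v ≤ c) :
    sumOver (S ∪ T) (fun w => f w * h w) v ≤ c * b := by
  rw [sumOver_union hST]
  calc _ ≤ sumOver S (fun w => f w * b) v := sumOver_le_sumOver fun w _ => by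
        rw [sumOver_mul_of_indep hf]
        exact mul_le_mul_of_nonneg_left (hb w) (hf0 w)
    _ = sumOver S f v * b := sumOver_mul_const _ _ _ _
    _ ≤ c * b := mul_le_mul_of_nonneg_right hc ((sumOver_nonneg hh0 v).trans (hb v))

theorem sumOver_mul_eq {S T : Finset ι} (hST : Disjoint S T) {f h : (ι → V) → ℝ}
    (hf : ∀ w w', (∀ i ∉ T, w i = w' i) → f w = f w')
    (hh : ∀ w w', (∀ i ∉ S, w i = w' i) → h w = h w') (v : ι → V) :
    sumOver (S ∪ T) (fun w => f w * h w) v = sumOver S f v * sumOver T h v := by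
  rw [sumOver_union hST, ← sumOver_mul_const]
  refine sumOver_congr fun w hw => ?_
  rw [sumOver_mul_of_indep hf]
  congr 1
  -- the sum over the coordinates in `T` does not see the coordinates in `S`
  unfold sumOver
  refine Finset.sum_bij' (fun p _ i => if i ∈ S then v i else p i)
    (fun p _ i => if i ∈ S then w i else p i) ?_ ?_ ?_ ?_ ?_
  · intro p hp
    rw [mem_sumOver_iff] at hp ⊢
    intro i hi
    by_cases hS : i ∈ S
    · simp [hS]
    · simp [hS, hp i hi, hw i hS]
  · intro p hp
    rw [mem_sumOver_iff] at hp ⊢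
    intro i hi
    by_cases hS : i ∈ S
    · simp [hS]
    · simp [hS, hp i hi, hw i hS]
  · intro p hp
    rw [mem_sumOver_iff] at hp
    funext i
    by_cases hS : i ∈ S
    · simp [hS, hp i (Finset.disjoint_left.1 hST hS)]
    · simp [hS]
  · intro p hp
    rw [mem_sumOver_iff] at hp
    funext i
    by_cases hS : i ∈ S
    · simp [hS, hp i (Finset.disjoint_left.1 hST hS)]
    · simp [hS]
  · intro p _
    exact hh _ _ fun i hi => by simp [hi]

theorem sumOver_prod (L : Finset ι) (h : ι → V → ℝ) (v : ι → V) :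
    sumOver L (fun w => ∏ i ∈ L, h i (w i)) v = ∏ i ∈ L, ∑ u, h i u := by
  have h1 : ∀ w : ι → V, ∏ i ∈ L, h i (w i) = ∏ i, if i ∈ L then h i (w i) else 1 := fun w => by
    rw [Finset.prod_ite_mem, Finset.univ_inter]
  unfold sumOver
  simp only [h1]
  rw [← Finset.prod_univ_sum (fun i => if i ∈ L then Finset.univ else {v i})
    (fun i u => if i ∈ L then h i u else 1), ← Finset.prod_subset (Finset.subset_univ L)]
  · refine Finset.prod_congr rfl fun i hi => ?_
    simp [hi]
  · intro i _ hi
    simp [hi]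

theorem sumOver_prod_sum_le {G : V → V → ℝ} (hG : ∀ u u', 0 ≤ G u u') {K : ℝ}
    (hK : ∀ u, ∑ u', G u u' ≤ K) {A L : Finset ι} (hAL : Disjoint A L) (v : ι → V) :
    sumOver L (fun w => ∏ y ∈ L, ∑ x ∈ A, G (w x) (w y)) v ≤ (A.card * K) ^ L.card := by
  have h1 : sumOver L (fun w => ∏ y ∈ L, ∑ x ∈ A, G (w x) (w y)) v =
      sumOver L (fun w => ∏ y ∈ L, ∑ x ∈ A, G (v x) (w y)) v := by
    refine sumOver_congr fun w hw => Finset.prod_congr rfl fun y _ =>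
      Finset.sum_congr rfl fun x hx => ?_
    rw [hw x (Finset.disjoint_left.1 hAL hx)]
  rw [h1, sumOver_prod L (fun _ u => ∑ x ∈ A, G (v x) u)]
  rw [Finset.prod_const]
  refine pow_le_pow_left₀ (Finset.sum_nonneg fun u _ => Finset.sum_nonneg fun x _ => hG _ _) ?_ _
  rw [Finset.sum_comm, ← nsmul_eq_mul]
  exact Finset.sum_le_card_nsmul _ _ _ fun x _ => hK _

omit [Fintype ι] [DecidableEq ι] in
theorem sum_powerset_pow_mul_factorial_le (B : Finset ι) {a x y K : ℝ} (ha : 0 ≤ a) (hx : 0 < x)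
    (hy : 0 ≤ y) (hK : 0 ≤ K) :
    ∑ L ∈ B.powerset, (a * K) ^ L.card *
        ((B.card - L.card).factorial * (x * K) ^ (B.card - L.card) * y ^ L.card) ≤
      B.card.factorial * (x * K) ^ B.card * Real.exp (a * y / x) := by
  rw [Finset.sum_powerset_apply_card (fun l => (a * K) ^ l *
        ((B.card - l).factorial * (x * K) ^ (B.card - l) * y ^ l))]
  have h1 : ∀ l ∈ Finset.range (B.card + 1), B.card.choose l • ((a * K) ^ l *
        ((B.card - l).factorial * (x * K) ^ (B.card - l) * y ^ l)) =
      B.card.factorial * (x * K) ^ B.card * ((a * y / x) ^ l / l.factorial) := by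
    intro l hl
    have hl' : l ≤ B.card := Nat.lt_succ_iff.1 (Finset.mem_range.1 hl)
    have h2 : (B.card.choose l : ℝ) * l.factorial * (B.card - l).factorial = B.card.factorial := by
      exact_mod_cast Nat.choose_mul_factorial_mul_factorial hl'
    have h3 : (x * K) ^ B.card = (x * K) ^ l * (x * K) ^ (B.card - l) := by
      rw [← pow_add, Nat.add_sub_cancel' hl']
    have h4 : (l.factorial : ℝ) ≠ 0 := by positivity
    have h5 : (a * y / x) ^ l * (x * K) ^ l = (a * K) ^ l * y ^ l := by
      rw [← mul_pow, ← mul_pow]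
      congr 1
      field_simp
    rw [← h2, h3, nsmul_eq_mul]
    field_simp
    linear_combination (-((B.card.choose l : ℝ) * (x * K) ^ (B.card - l))) * h5
  rw [Finset.sum_congr rfl h1, ← Finset.mul_sum]
  exact mul_le_mul_of_nonneg_left (Real.sum_le_exp_of_nonneg (by positivity) _) (by positivity)

/-- The number of forests with `n` points and `a` roots is at most `n! * exp (n + a)`, and each
edge contributes at most `K` after summation over the position of its child. -/
theorem sumOver_forestSum_le {G : V → V → ℝ} (hG : ∀ u u', 0 ≤ G u u') {K : ℝ} (hK0 : 0 ≤ K)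
    (hK : ∀ u, ∑ u', G u u' ≤ K) {A B : Finset ι} (hAB : Disjoint A B) (v : ι → V) :
    sumOver B (fun w => forestSum (fun x y => G (w x) (w y)) A B) v ≤
      B.card.factorial * (Real.exp 1 * K) ^ B.card * Real.exp 1 ^ A.card := by
  induction B using Finset.strongInduction generalizing A v with
  | H B ih =>
  rcases B.eq_empty_or_nonempty with rfl | hB
  · rw [sumOver_empty, forestSum_empty]
    simp only [Finset.card_empty, Nat.factorial_zero, Nat.cast_one, pow_zero, mul_one, one_mul]
    exact one_le_pow₀ (Real.one_le_exp zero_le_one)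
  · simp only [forestSum_of_nonempty _ A hB]
    rw [sumOver_sum]
    have hterm : ∀ L ∈ B.powerset.erase ∅,
        sumOver B (fun w => (∏ y ∈ L, ∑ x ∈ A, G (w x) (w y)) *
          forestSum (fun x y => G (w x) (w y)) L (B \ L)) v ≤
        (A.card * K) ^ L.card * ((B.card - L.card).factorial *
          (Real.exp 1 * K) ^ (B.card - L.card) * Real.exp 1 ^ L.card) := by
      intro L hL
      have hL := Finset.mem_erase.1 hL
      have hLB := Finset.mem_powerset.1 hL.2
      have hd : Disjoint L (B \ L) := Finset.disjoint_sdiff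
      have h1 := sumOver_mul_le hd
        (f := fun w : ι → V => ∏ y ∈ L, ∑ x ∈ A, G (w x) (w y))
        (h := fun w : ι → V => forestSum (fun x y => G (w x) (w y)) L (B \ L))
        (fun w => Finset.prod_nonneg fun y _ => Finset.sum_nonneg fun x _ => hG _ _)
        (fun w => forestSum_nonneg (fun _ _ => hG _ _) _ _)
        (fun w w' hw => Finset.prod_congr rfl fun y hy => Finset.sum_congr rfl fun x hx => by
          rw [hw x (Finset.disjoint_left.1 (hAB.mono_right Finset.sdiff_subset) hx),
            hw y (Finset.disjoint_left.1 hd hy)])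
        (fun w => ih _ (Finset.sdiff_ssubset hLB (Finset.nonempty_iff_ne_empty.2 hL.1)) hd w)
        (sumOver_prod_sum_le hG hK (hAB.mono_right hLB) v)
      rw [Finset.union_sdiff_of_subset hLB, Finset.card_sdiff_of_subset hLB] at h1
      exact h1
    refine (Finset.sum_le_sum hterm).trans ?_
    refine (Finset.sum_le_sum_of_subset_of_nonneg (Finset.erase_subset _ _)
      fun L _ _ => by positivity).trans ?_
    refine (sum_powerset_pow_mul_factorial_le B (Nat.cast_nonneg _) (Real.exp_pos 1)
      (Real.exp_pos 1).le hK0).trans (le_of_eq ?_)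
    rw [mul_div_cancel_right₀ _ (Real.exp_pos 1).ne', Real.exp_one_pow]

theorem sum_half_pow_le (n : ℕ) : ∑ j ∈ Finset.range (n + 1), ((1 : ℝ) / 2) ^ j ≤ 2 := by
  have h := geom_sum_eq (x := (1 / 2 : ℝ)) (by norm_num) (n + 1)
  have h0 : (0 : ℝ) ≤ (1 / 2) ^ (n + 1) := by positivity
  have h1 : (((1 : ℝ) / 2) ^ (n + 1) - 1) / (1 / 2 - 1) = 2 - 2 * (1 / 2) ^ (n + 1) := by ring
  rw [h, h1]
  linarith

omit [Fintype ι] [DecidableEq ι] in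
theorem sum_powerset_factorial_le (B : Finset ι) {a K : ℝ} (ha : 1 ≤ a) (hK : 0 ≤ K) :
    ∑ D ∈ B.powerset, 2 ^ D.card * (D.card.factorial * (Real.exp 1 * K) ^ D.card * Real.exp a) *
        ((B.card - D.card).factorial * (4 * Real.exp 2 * K) ^ (B.card - D.card) *
          Real.exp (a + D.card)) ≤
      B.card.factorial * (4 * Real.exp 2 * K) ^ B.card * (2 * Real.exp 2 ) ^ a := by
  rw [Finset.sum_powerset_apply_card (fun j => 2 ^ j * (j.factorial * (Real.exp 1 * K) ^ j *
    Real.exp a) * ((B.card - j).factorial * (4 * Real.exp 2 * K) ^ (B.card - j) *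
          Real.exp (a + j)))]
  have h1 : ∀ j ∈ Finset.range (B.card + 1), B.card.choose j • (2 ^ j * (j.factorial *
      (Real.exp 1 * K) ^ j * Real.exp a) * ((B.card - j).factorial *
        (4 * Real.exp 2 * K) ^ (B.card - j) * Real.exp (a + j))) =
      B.card.factorial * (4 * Real.exp 2 * K) ^ B.card * Real.exp (2 * a) * (1 / 2) ^ j := by
    intro j hj
    have hj' : j ≤ B.card := Nat.lt_succ_iff.1 (Finset.mem_range.1 hj)
    have h2 : (B.card.choose j : ℝ) * j.factorial * (B.card - j).factorial = B.card.factorial := by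
      exact_mod_cast Nat.choose_mul_factorial_mul_factorial hj'
    have h3 : (4 * Real.exp 2 * K) ^ B.card =
        (4 * Real.exp 2 * K) ^ j * (4 * Real.exp 2 * K) ^ (B.card - j) := by
      rw [← pow_add, Nat.add_sub_cancel' hj']
    have h5 : Real.exp (a + j) = Real.exp a * Real.exp 1 ^ j := by
      rw [Real.exp_add, Real.exp_one_pow]
    have h6 : Real.exp 2 = Real.exp 1 * Real.exp 1 := by rw [← Real.exp_add]; norm_num
    have h7 : Real.exp (2 * a) = Real.exp a * Real.exp a := by rw [← Real.exp_add, two_mul]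
    have h8 : (4 * Real.exp 2 * K) ^ j * (1 / 2) ^ j =
        2 ^ j * (Real.exp 1 * K) ^ j * Real.exp 1 ^ j := by
      rw [← mul_pow, ← mul_pow, ← mul_pow, h6]; ring
    rw [← h2, h3, nsmul_eq_mul, h5, h7]
    linear_combination (-((B.card.choose j : ℝ) * j.factorial * (B.card - j).factorial *
      (4 * Real.exp 2 * K) ^ (B.card - j) * (Real.exp a * Real.exp a))) * h8
  rw [Finset.sum_congr rfl h1, ← Finset.mul_sum]
  have h9 : Real.exp (2 * a) * 2 ≤ (2 * Real.exp 2) ^ a := by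
    rw [Real.mul_rpow (by norm_num) (Real.exp_pos 2).le, ← Real.exp_mul, mul_comm]
    refine mul_le_mul_of_nonneg_right ?_ (Real.exp_pos _).le
    calc (2 : ℝ) = 2 ^ (1 : ℝ) := (Real.rpow_one 2).symm
      _ ≤ 2 ^ a := Real.rpow_le_rpow_of_exponent_le (by norm_num) ha
  calc _ ≤ B.card.factorial * (4 * Real.exp 2 * K) ^ B.card * Real.exp (2 * a) * 2 :=
        mul_le_mul_of_nonneg_left (sum_half_pow_le _) (by positivity)
    _ = B.card.factorial * (4 * Real.exp 2 * K) ^ B.card * (Real.exp (2 * a) * 2) := by ring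
    _ ≤ _ := mul_le_mul_of_nonneg_left h9 (by positivity)

/-- The decisive summation: the absolute values of the `pinned` coefficients, summed over the
positions of the points of `B`, are of order `(card B)!` times a power. The factor
`(4 * exp 2 * K) ^ n * (2 * exp 2) ^ a` is chosen so that it reproduces itself in the recursion.
-/
theorem sumOver_abs_pinned_le {μ : (ι → V) → Finset ι → ℝ} {R : V → V → ℕ} {ε e : ℕ → ℝ} {k : ℕ}
    (H : ∀ w, WeakFactor (μ w) (fun i j => R (w i) (w j)) ε k)
    (he0 : ∀ h, 0 ≤ e h) (he1 : ∀ h, e h ≤ 1) (hanti : Antitone e)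
    (hpow : ∀ h, ε h ≤ e h ^ k) {K : ℝ} (hK0 : 0 ≤ K) (hK : ∀ u, ∑ u', e (R u u') ≤ K)
    {A B : Finset ι} (hA : A.Nonempty) (hAB : Disjoint A B) (hk : (A ∪ B).card ≤ k) (v : ι → V) :
    sumOver B (fun w => |pinned (μ w) A B|) v ≤
      B.card.factorial * (4 * Real.exp 2 * K) ^ B.card * (2 * Real.exp 2) ^ A.card := by
  induction B using Finset.strongInduction generalizing A v with
  | H B ih =>
  have hG : ∀ u u', 0 ≤ e (R u u') := fun _ _ => he0 _
  refine (sumOver_le_sumOver fun w _ =>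
    abs_pinned_le (H w) he0 he1 hanti hpow hA hAB hk).trans ?_
  rw [sumOver_sum]
  have hA1 : (1 : ℝ) ≤ A.card := by exact_mod_cast hA.card_pos
  rw [← Real.rpow_natCast (2 * Real.exp 2)]
  refine le_trans (Finset.sum_le_sum fun D hD => ?_) (sum_powerset_factorial_le B hA1 hK0)
  rw [Finset.mem_powerset] at hD
  have hd : Disjoint D (B \ D) := Finset.disjoint_sdiff
  have hAD : Disjoint A D := hAB.mono_right hD
  have hABD : Disjoint (A ∪ D) (B \ D) :=
    Finset.disjoint_union_left.2 ⟨hAB.mono_right Finset.sdiff_subset, hd⟩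
  have hcardBD : (B \ D).card = B.card - D.card := Finset.card_sdiff_of_subset hD
  have hcAD : ((A ∪ D).card : ℝ) = A.card + D.card := by
    exact_mod_cast Finset.card_union_of_disjoint hAD
  have hforest : sumOver D (fun w : ι → V =>
      2 ^ D.card * forestSum (fun x y => e (R (w x) (w y))) A D) v ≤
      2 ^ D.card * (D.card.factorial * (Real.exp 1 * K) ^ D.card * Real.exp A.card) := by
    have h1 := sumOver_forestSum_le hG hK0 hK hAD v
    rw [Real.exp_one_pow] at h1
    have h2 := mul_le_mul_of_nonneg_right h1 (by positivity : (0 : ℝ) ≤ 2 ^ D.card)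
    rw [← sumOver_mul_const] at h2
    simp only [mul_comm _ ((2 : ℝ) ^ D.card)] at h2
    exact h2
  have hinner : ∀ w : ι → V, sumOver (B \ D) (fun w => ∑ Y ∈ (B \ D).powerset,
      (∏ y ∈ Y, ∑ x ∈ A ∪ D, e (R (w x) (w y))) * |pinned (μ w) Y ((B \ D) \ Y)|) w ≤
      (B.card - D.card).factorial * (4 * Real.exp 2 * K) ^ (B.card - D.card) *
          Real.exp (A.card + D.card) := by
    intro w
    rw [sumOver_sum]
    have hterm : ∀ Y ∈ (B \ D).powerset, sumOver (B \ D) (fun w =>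
        (∏ y ∈ Y, ∑ x ∈ A ∪ D, e (R (w x) (w y))) * |pinned (μ w) Y ((B \ D) \ Y)|) w ≤
        ((A.card + D.card : ℝ) * K) ^ Y.card * (((B \ D).card - Y.card).factorial *
          (4 * Real.exp 2 * K) ^ ((B \ D).card - Y.card) * (2 * Real.exp 2) ^ Y.card) := by
      intro Y hY
      rw [Finset.mem_powerset] at hY
      have hdY : Disjoint Y ((B \ D) \ Y) := Finset.disjoint_sdiff
      have hpin : ∀ w' : ι → V, sumOver ((B \ D) \ Y)
          (fun w => |pinned (μ w) Y ((B \ D) \ Y)|) w' ≤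
          ((B \ D).card - Y.card).factorial *
          (4 * Real.exp 2 * K) ^ ((B \ D).card - Y.card) * (2 * Real.exp 2) ^ Y.card := by
        intro w'
        rw [← Finset.card_sdiff_of_subset hY]
        rcases Y.eq_empty_or_nonempty with rfl | hYne
        · -- without excluded points the recursion stops, and no points may remain
          simp only [fun w => pinned_empty (H w).empty, Finset.sdiff_empty]
          rcases (B \ D).eq_empty_or_nonempty with h0 | h0
          · rw [h0, sumOver_empty]; simp
          · rw [if_neg h0.ne_empty, abs_zero]
            have : sumOver (B \ D) (fun _ : ι → V => (0 : ℝ)) w' = 0 := by simp [sumOver]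
            rw [this]; positivity
        · have hss : (B \ D) \ Y ⊂ B :=
            (Finset.sdiff_ssubset hY hYne).trans_subset Finset.sdiff_subset
          refine ih _ hss hYne hdY ?_ w'
          rw [Finset.union_sdiff_of_subset hY]
          exact (Finset.card_le_card
            (Finset.sdiff_subset.trans Finset.subset_union_right)).trans hk
      have h1 := sumOver_mul_le hdY
        (f := fun w : ι → V => ∏ y ∈ Y, ∑ x ∈ A ∪ D, e (R (w x) (w y)))
        (h := fun w : ι → V => |pinned (μ w) Y ((B \ D) \ Y)|)
        (fun w => Finset.prod_nonneg fun y _ => Finset.sum_nonneg fun x _ => hG _ _)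
        (fun w => abs_nonneg _)
        (fun w w' hw => Finset.prod_congr rfl fun y hy => Finset.sum_congr rfl fun x hx => by
          rw [hw x (Finset.disjoint_left.1 (hABD.mono_right Finset.sdiff_subset) hx),
            hw y (Finset.disjoint_left.1 hdY hy)])
        hpin (sumOver_prod_sum_le hG hK (hABD.mono_right hY) w)
      rwa [Finset.union_sdiff_of_subset hY, hcAD] at h1
    refine (Finset.sum_le_sum hterm).trans ?_
    refine (sum_powerset_pow_mul_factorial_le (B \ D) (by positivity) (by positivity)
      (by positivity) hK0).trans ?_
    rw [hcardBD]
    refine mul_le_mul_of_nonneg_left (Real.exp_le_exp.2 ?_) (by positivity)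
    rw [div_le_iff₀ (by positivity)]
    have : (0 : ℝ) ≤ (A.card + D.card : ℝ) * Real.exp 2 := by positivity
    nlinarith
  have h1 := sumOver_mul_le hd
    (f := fun w : ι → V => 2 ^ D.card * forestSum (fun x y => e (R (w x) (w y))) A D)
    (h := fun w : ι → V => ∑ Y ∈ (B \ D).powerset,
      (∏ y ∈ Y, ∑ x ∈ A ∪ D, e (R (w x) (w y))) * |pinned (μ w) Y ((B \ D) \ Y)|)
    (fun w => mul_nonneg (by positivity) (forestSum_nonneg (fun _ _ => hG _ _) _ _))
    (fun w => Finset.sum_nonneg fun Y _ => mul_nonneg (Finset.prod_nonneg fun y _ =>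
      Finset.sum_nonneg fun x _ => hG _ _) (abs_nonneg _))
    (fun w w' hw => by
      have : ∀ x ∈ A ∪ D, w x = w' x := fun x hx => hw x (Finset.disjoint_left.1 hABD hx)
      rw [forestSum_congr fun x hx y hy => by rw [this x hx, this y hy]])
    hinner hforest
  rwa [Finset.union_sdiff_of_subset hD] at h1

end

/-! ### Moments and cumulants of a sum -/

section

/-- The recursion between moments and cumulants: the Leibniz rule for `φ' = φ * (log φ)'` at `0`,
where `φ` is the characteristic function of `W`. -/
theorem cumulant_recursion {Ω : Type*} [MeasurableSpace Ω] {P : Measure Ω} [IsProbabilityMeasure P]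
    {W : Ω → ℝ} (hW : ∀ k : ℕ, MemLp W k P) (n : ℕ) :
    ((∫ ω, W ω ^ (n + 1) ∂P : ℝ) : ℂ) = ∑ j ∈ Finset.range (n + 1),
      (n.choose j : ℂ) * cumulant P W (j + 1) * ((∫ ω, W ω ^ (n - j) ∂P : ℝ) : ℂ) := by
  have hWm : AEMeasurable W P := (hW 0).1.aemeasurable
  have : IsProbabilityMeasure (P.map W) := Measure.isProbabilityMeasure_map hWm
  have hid : ∀ k : ℕ, MemLp id k (P.map W) := fun k =>
    (memLp_map_measure_iff aestronglyMeasurable_id hWm).2 (hW k)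
  set φ : ℝ → ℂ := charFun (P.map W) with hφ
  set ℓ : ℝ → ℂ := fun t => Complex.log (φ t) with hℓ
  have hφs : ContDiff ℝ ((⊤ : ℕ∞) : WithTop ℕ∞) φ := contDiff_charFun' hid
  have hφ0 : φ 0 = 1 := by simp [hφ]
  -- near `0` the principal logarithm is differentiable at the values of `φ`
  have hslit : ∀ᶠ t in nhds (0 : ℝ), φ t ∈ Complex.slitPlane := by
    refine hφs.continuous.continuousAt.eventually_mem ?_
    rw [hφ0]
    exact Complex.isOpen_slitPlane.mem_nhds Complex.one_mem_slitPlane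
  have hφd : Differentiable ℝ φ := hφs.differentiable (by simp)
  have hderiv : deriv φ =ᶠ[nhds 0] fun t => φ t * deriv ℓ t := by
    filter_upwards [hslit] with t ht
    have h1 : HasDerivAt ℓ (deriv φ t / φ t) t := (hφd t).hasDerivAt.clog_real ht
    rw [h1.deriv, mul_div_cancel₀ _ (Complex.slitPlane_ne_zero ht)]
  have hℓs : ContDiffAt ℝ ((⊤ : ℕ∞) : WithTop ℕ∞) ℓ 0 := by
    have h1 : ContDiffAt ℝ ((⊤ : ℕ∞) : WithTop ℕ∞) Complex.log (φ 0) :=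
      (Complex.contDiffAt_log (by rw [hφ0]; exact Complex.one_mem_slitPlane)).restrict_scalars ℝ
    exact h1.comp (0 : ℝ) hφs.contDiffAt
  have hℓ's : ContDiffAt ℝ (n : WithTop ℕ∞) (deriv ℓ) 0 := by
    have h2 : ContDiffAt ℝ ((⊤ : ℕ∞) : WithTop ℕ∞) (deriv ℓ) 0 := hℓs.derivWithin (by simp)
    exact h2.of_le (by exact_mod_cast le_top)
  have hmom : ∀ j, iteratedDeriv j φ 0 = Complex.I ^ j * ((∫ ω, W ω ^ j ∂P : ℝ) : ℂ) := fun j => by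
    rw [hφ, iteratedDeriv_charFun_zero (hid j), integral_map hWm (by fun_prop)]
  have hcum : ∀ j, iteratedDeriv j (deriv ℓ) 0 = Complex.I ^ (j + 1) * cumulant P W (j + 1) := by
    intro j
    rw [cumulant, ← iteratedDeriv_succ', mul_inv_cancel_left₀ (pow_ne_zero _ Complex.I_ne_zero)]
  have h1 : iteratedDeriv (n + 1) φ 0 = ∑ i ∈ Finset.range (n + 1), (n.choose i : ℂ) *
      iteratedDeriv i φ 0 * iteratedDeriv (n - i) (deriv ℓ) 0 := by
    rw [iteratedDeriv_succ', hderiv.iteratedDeriv_eq n]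
    exact iteratedDeriv_fun_mul
      (hφs.contDiffAt.of_le (by exact_mod_cast le_top)) hℓ's
  rw [hmom] at h1
  rw [← mul_right_inj' (pow_ne_zero (n + 1) Complex.I_ne_zero), h1, ← Finset.sum_range_reflect,
    Finset.mul_sum]
  refine Finset.sum_congr rfl fun j hj => ?_
  have hj' : j ≤ n := Nat.lt_succ_iff.1 (Finset.mem_range.1 hj)
  have e1 : n + 1 - 1 - j = n - j := by omega
  have e2 : n - (n - j) = j := by omega
  rw [e1, e2, hmom, hcum, Nat.choose_symm hj']
  have e3 : Complex.I ^ (n + 1) = Complex.I ^ (n - j) * Complex.I ^ (j + 1) := by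
    rw [← pow_add]; congr 1; omega
  rw [e3]
  ring

variable {Ω : Type*} [MeasurableSpace Ω] {P : Measure Ω} [IsProbabilityMeasure P]

theorem integrable_finset_prod {ι : Type*} (B : Finset ι) {f : ι → Ω → ℝ}
    (hf : ∀ i, ∀ k : ℕ, MemLp (f i) k P) : Integrable (fun ω => ∏ i ∈ B, f i ω) P := by
  rcases B.eq_empty_or_nonempty with rfl | hB
  · simp
  · have h := MemLp.prod' (s := B) (p := fun _ => (B.card : ℝ≥0∞)) (μ := P)
      fun i _ => hf i B.card
    rw [Finset.sum_const, nsmul_eq_mul, ENNReal.mul_inv_cancel (by simpa using hB.ne_empty)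
      (ENNReal.natCast_ne_top _), inv_one] at h
    exact memLp_one_iff_integrable.1 h

/-- Hölder's inequality for a product of at most `k` functions. -/
theorem abs_integral_prod_le_one {ι : Type*} (B : Finset ι) {f : ι → Ω → ℝ} {k : ℕ}
    (hm : ∀ i, AEStronglyMeasurable (f i) P) (hk : B.card ≤ k)
    (hf : ∀ i, eLpNorm (f i) k P ≤ 1) : |∫ ω, ∏ i ∈ B, f i ω ∂P| ≤ 1 := by
  rcases B.eq_empty_or_nonempty with rfl | hB
  · simp
  have hn : (0 : ℝ) < B.card := by exact_mod_cast hB.card_pos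
  have h1 : ∫⁻ ω, ‖∏ i ∈ B, f i ω‖ₑ ∂P ≤ 1 := by
    have h2 := ENNReal.lintegral_prod_norm_pow_le (μ := P) B
      (f := fun i ω => ‖f i ω‖ₑ ^ (B.card : ℝ)) (p := fun _ => (B.card : ℝ)⁻¹)
      (fun i _ => (hm i).enorm.pow_const _)
      (by rw [Finset.sum_const, nsmul_eq_mul, mul_inv_cancel₀ hn.ne']) (fun _ _ => by positivity)
    calc ∫⁻ ω, ‖∏ i ∈ B, f i ω‖ₑ ∂P
        = ∫⁻ ω, ∏ i ∈ B, (‖f i ω‖ₑ ^ (B.card : ℝ)) ^ (B.card : ℝ)⁻¹ ∂P := by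
          refine lintegral_congr fun ω => ?_
          simp only [ENNReal.rpow_rpow_inv hn.ne']
          simp [enorm_eq_nnnorm, nnnorm_prod]
      _ ≤ _ := h2
      _ ≤ ∏ i ∈ B, 1 := by
          refine Finset.prod_le_prod' fun i _ => ?_
          have h3 : eLpNorm (f i) B.card P ≤ 1 :=
            (eLpNorm_le_eLpNorm_of_exponent_le (by exact_mod_cast hk) (hm i)).trans (hf i)
          rw [eLpNorm_eq_lintegral_rpow_enorm_toReal (by exact_mod_cast hB.card_pos.ne')
            (ENNReal.natCast_ne_top _)] at h3
          simpa using h3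
      _ = 1 := by simp
  have h4 : ‖∫ ω, ∏ i ∈ B, f i ω ∂P‖ₑ ≤ 1 := (enorm_integral_le_lintegral_enorm _).trans h1
  rw [← Real.norm_eq_abs, ← toReal_enorm]
  exact ENNReal.toReal_le_of_le_ofReal zero_le_one (by simpa using h4)

/-- The mixed moment `𝔼 ∏_{i ∈ B} X (v i)` along the tuple `v`, as a function of the index set
`B`. -/
noncomputable def mixedMoment {ι V : Type*} (P : Measure Ω) (X : V → Ω → ℝ) (v : ι → V)
    (B : Finset ι) : ℝ :=
  ∫ ω, ∏ i ∈ B, X (v i) ω ∂P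

variable {ι : Type*} [DecidableEq ι] [Fintype ι] {V : Type*} [Fintype V]

theorem sumOver_mixedMoment {X : V → Ω → ℝ} (hX : ∀ v, ∀ k : ℕ, MemLp (X v) k P) (B : Finset ι)
    (v : ι → V) :
    sumOver B (fun w => mixedMoment P X w B) v = ∫ ω, (∑ u, X u ω) ^ B.card ∂P := by
  unfold sumOver mixedMoment
  rw [← integral_finsetSum _ fun w _ => integrable_finset_prod B fun i => hX (w i)]
  refine integral_congr_ae (Filter.Eventually.of_forall fun ω => ?_)
  have := sumOver_prod B (fun _ u => X u ω) v
  rw [Finset.prod_const] at this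
  exact this

omit [Fintype ι] [Fintype V] [DecidableEq ι] in
theorem mixedMoment_empty (X : V → Ω → ℝ) (v : ι → V) : mixedMoment P X v ∅ = 1 := by
  simp [mixedMoment]

omit [IsProbabilityMeasure P] [Fintype ι] [Fintype V] [DecidableEq ι] in
theorem mixedMoment_congr (X : V → Ω → ℝ) {v w : ι → V} {B : Finset ι}
    (h : ∀ i ∈ B, v i = w i) : mixedMoment P X v B = mixedMoment P X w B := by
  unfold mixedMoment
  refine integral_congr_ae (Filter.Eventually.of_forall fun ω => ?_)
  exact Finset.prod_congr rfl fun i hi => by rw [h i hi]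

/-- Multilinearity of cumulants: the joint cumulants, summed over all tuples, give the cumulant of
the sum. Both sides satisfy the recursion `cumulant_recursion`. -/
theorem sumOver_pinned_mixedMoment {X : V → Ω → ℝ} (hX : ∀ v, ∀ k : ℕ, MemLp (X v) k P)
    (i₀ : ι) (B : Finset ι) (hB : i₀ ∉ B) (v : ι → V) :
    ((sumOver (insert i₀ B) (fun w => pinned (mixedMoment P X w) {i₀} B) v : ℝ) : ℂ) =
      cumulant P (fun ω => ∑ u, X u ω) (B.card + 1) := by
  induction B using Finset.strongInduction with
  | H B ih =>
  have hWL : ∀ k : ℕ, MemLp (fun ω => ∑ u, X u ω) k P := fun k =>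
    memLp_finsetSum _ fun u _ => hX u k
  have hrec := cumulant_recursion hWL B.card
  have hsum : ((∫ ω, (∑ u, X u ω) ^ (B.card + 1) ∂P : ℝ) : ℂ) =
      ∑ D ∈ B.powerset,
        ((sumOver (insert i₀ D) (fun w => pinned (mixedMoment P X w) {i₀} D) v : ℝ) : ℂ) *
          ((∫ ω, (∑ u, X u ω) ^ (B.card - D.card) ∂P : ℝ) : ℂ) := by
    rw [← Finset.card_insert_of_notMem hB, ← sumOver_mixedMoment hX (insert i₀ B) v]
    norm_cast
    have h1 : ∀ w : ι → V, mixedMoment P X w (insert i₀ B) = ∑ D ∈ B.powerset,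
        pinned (mixedMoment P X w) {i₀} D * mixedMoment P X w (B \ D) := fun w => by
      rw [sum_pinned_mul (mixedMoment_empty X w), ← Finset.insert_eq]
    simp only [h1]
    rw [sumOver_sum]
    refine Finset.sum_congr rfl fun D hD => ?_
    rw [Finset.mem_powerset] at hD
    have hd : Disjoint (insert i₀ D) (B \ D) := by
      rw [Finset.disjoint_insert_left]
      exact ⟨fun h => hB (Finset.sdiff_subset h), Finset.disjoint_sdiff⟩
    have hu : insert i₀ B = insert i₀ D ∪ (B \ D) := by
      rw [Finset.insert_union, Finset.union_sdiff_of_subset hD]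
    rw [hu, sumOver_mul_eq hd, sumOver_mixedMoment hX, Finset.card_sdiff_of_subset hD]
    · intro w w' hw
      refine pinned_congr fun S hS => mixedMoment_congr X fun i hi => hw i ?_
      exact Finset.disjoint_left.1 hd (by rw [Finset.insert_eq]; exact hS hi)
    · intro w w' hw
      exact mixedMoment_congr X fun i hi => hw i (Finset.disjoint_right.1 hd hi)
  have hpow : ∑ j ∈ Finset.range (B.card + 1), (B.card.choose j : ℂ) *
      cumulant P (fun ω => ∑ u, X u ω) (j + 1) *
        ((∫ ω, (∑ u, X u ω) ^ (B.card - j) ∂P : ℝ) : ℂ) =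
      ∑ D ∈ B.powerset, cumulant P (fun ω => ∑ u, X u ω) (D.card + 1) *
        ((∫ ω, (∑ u, X u ω) ^ (B.card - D.card) ∂P : ℝ) : ℂ) := by
    rw [Finset.sum_powerset_apply_card (fun j => cumulant P (fun ω => ∑ u, X u ω) (j + 1) *
        ((∫ ω, (∑ u, X u ω) ^ (B.card - j) ∂P : ℝ) : ℂ))]
    exact Finset.sum_congr rfl fun j _ => by rw [nsmul_eq_mul, mul_assoc]
  rw [hpow, hsum, sum_powerset_eq_add_ssubsets, sum_powerset_eq_add_ssubsets,
    Finset.sum_congr rfl fun D hD => by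
      have hD' := Finset.mem_ssubsets.1 hD
      rw [ih D hD' fun h => hB (hD'.1 h)]] at hrec
  simpa using add_right_cancel hrec

theorem cumulant_const_mul {W : Ω → ℝ} (hW : ∀ k : ℕ, MemLp W k P) (c : ℝ) (n : ℕ) :
    cumulant P (fun ω => c * W ω) (n + 1) = (c : ℂ) ^ (n + 1) * cumulant P W (n + 1) := by
  induction n using Nat.strong_induction_on with
  | _ n ih =>
  have h1 := cumulant_recursion hW n
  have h2 := cumulant_recursion (fun k => (hW k).const_mul c) n
  simp only [mul_pow, integral_const_mul] at h2
  rw [Complex.ofReal_mul, h1, Finset.sum_range_succ, Finset.sum_range_succ, mul_add] at h2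
  have h3 : ((c ^ (n + 1) : ℝ) : ℂ) * ∑ j ∈ Finset.range n, (n.choose j : ℂ) *
      cumulant P W (j + 1) * ((∫ ω, W ω ^ (n - j) ∂P : ℝ) : ℂ) =
      ∑ j ∈ Finset.range n, (n.choose j : ℂ) * cumulant P (fun ω => c * W ω) (j + 1) *
        ((c ^ (n - j) * ∫ ω, W ω ^ (n - j) ∂P : ℝ) : ℂ) := by
    rw [Finset.mul_sum]
    refine Finset.sum_congr rfl fun j hj => ?_
    have hj' := Finset.mem_range.1 hj
    rw [ih j hj']
    have : (c : ℂ) ^ (n + 1) = (c : ℂ) ^ (j + 1) * (c : ℂ) ^ (n - j) := by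
      rw [← pow_add]; congr 1; omega
    push_cast
    rw [this]
    ring
  have h4 := add_left_cancel (h3 ▸ h2)
  simpa using h4.symm

/-- The cumulant of order `n + 1` is the sum over all tuples of the coefficients `pinned` with a
single pinned point, whose position contributes the factor `card V`. -/
theorem norm_cumulant_le_of_weakFactor [Nonempty V] {X : V → Ω → ℝ}
    (hX : ∀ v, ∀ k : ℕ, MemLp (X v) k P) (n : ℕ) {R : V → V → ℕ} {ε e : ℕ → ℝ}
    (H : ∀ w : Fin (n + 1) → V,
      WeakFactor (mixedMoment P X w) (fun i j => R (w i) (w j)) ε (n + 1))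
    (he0 : ∀ h, 0 ≤ e h) (he1 : ∀ h, e h ≤ 1) (hanti : Antitone e)
    (hpow : ∀ h, ε h ≤ e h ^ (n + 1)) {K : ℝ} (hK0 : 0 ≤ K) (hK : ∀ u, ∑ u', e (R u u') ≤ K) :
    ‖cumulant P (fun ω => ∑ v, X v ω) (n + 1)‖ ≤
      Fintype.card V * (n.factorial * (4 * Real.exp 2 * K) ^ n * (2 * Real.exp 2)) := by
  set B : Finset (Fin (n + 1)) := Finset.univ.erase 0 with hB
  have hBc : B.card = n := by simp [hB]
  have h0B : (0 : Fin (n + 1)) ∉ B := by simp [hB]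
  have hins : ({0} : Finset (Fin (n + 1))) ∪ B = Finset.univ := by
    rw [← Finset.insert_eq]; exact Finset.insert_erase (Finset.mem_univ _)
  obtain ⟨v⟩ : Nonempty (Fin (n + 1) → V) := inferInstance
  have h1 := sumOver_pinned_mixedMoment (P := P) hX 0 B h0B v
  rw [hBc] at h1
  rw [← h1, Complex.norm_real, Real.norm_eq_abs, Finset.insert_eq]
  have hd : Disjoint ({0} : Finset (Fin (n + 1))) B := Finset.disjoint_singleton_left.2 h0B
  have h2 : ∀ w : Fin (n + 1) → V, sumOver B (fun w => |pinned (mixedMoment P X w) {0} B|) w ≤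
      n.factorial * (4 * Real.exp 2 * K) ^ n * (2 * Real.exp 2) := by
    intro w
    have := sumOver_abs_pinned_le H he0 he1 hanti hpow hK0 hK (Finset.singleton_nonempty 0) hd
      (by rw [hins]; simp) w
    simpa [hBc] using this
  have h3 : sumOver ({0} : Finset (Fin (n + 1))) (fun _ : Fin (n + 1) → V => (1 : ℝ)) v ≤
      Fintype.card V := by
    have := sumOver_prod ({0} : Finset (Fin (n + 1))) (fun _ (_ : V) => (1 : ℝ)) v
    simp only [Finset.prod_const_one] at this
    rw [this]
    simp
  have h4 := sumOver_mul_le hd (fun _ => zero_le_one) (fun _ => abs_nonneg _)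
    (fun _ _ _ => rfl) h2 h3
  refine (Finset.abs_sum_le_sum_abs _ _).trans ?_
  simpa [sumOver] using h4

end

/-! ### Weights on a field of polynomial growth -/

section

theorem summable_rpow_mul_exp_neg_rpow {a u₀ η : ℝ} (ha : 0 < a) (hη : 0 < η) :
    Summable fun l : ℕ => ((l : ℝ) + 1) ^ u₀ * Real.exp (-a * ((l : ℝ) / 2) ^ η) := by
  have hten : Filter.Tendsto (fun l : ℕ => ((l : ℝ) / 2) ^ η) Filter.atTop Filter.atTop :=
    (tendsto_rpow_atTop hη).comp
      (tendsto_natCast_atTop_atTop.atTop_div_const (by norm_num))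
  have h1 := ((isLittleO_exp_neg_mul_rpow_atTop ha (-(u₀ + 2) / η)).comp_tendsto hten).isBigO
  have h2 : (fun l : ℕ => ((l : ℝ) + 1) ^ u₀) =O[Filter.atTop] fun l : ℕ => (l : ℝ) ^ u₀ := by
    refine Asymptotics.IsBigO.of_bound (2 ^ |u₀|) ?_
    filter_upwards [Filter.eventually_ge_atTop 1] with l hl
    have hl' : (1 : ℝ) ≤ l := by exact_mod_cast hl
    have e1 : ((l : ℝ) + 1) ^ u₀ = (((l : ℝ) + 1) / l) ^ u₀ * (l : ℝ) ^ u₀ := by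
      rw [← Real.mul_rpow (by positivity) (by positivity), div_mul_cancel₀ _ (by positivity)]
    rw [Real.norm_of_nonneg (by positivity), Real.norm_of_nonneg (by positivity), e1]
    refine mul_le_mul_of_nonneg_right ?_ (by positivity)
    have h3 : 1 ≤ ((l : ℝ) + 1) / l := by rw [le_div_iff₀ (by positivity)]; linarith
    have h4 : ((l : ℝ) + 1) / l ≤ 2 := by rw [div_le_iff₀ (by positivity)]; linarith
    calc _ ≤ (((l : ℝ) + 1) / l) ^ |u₀| := Real.rpow_le_rpow_of_exponent_le h3 (le_abs_self _)
      _ ≤ _ := Real.rpow_le_rpow (by positivity) h4 (abs_nonneg _)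
  have h5 : (fun l : ℕ => (((l : ℝ) / 2) ^ η) ^ (-(u₀ + 2) / η)) =O[Filter.atTop]
      fun l : ℕ => (l : ℝ) ^ (-(u₀ + 2)) := by
    refine Asymptotics.IsBigO.of_bound (2⁻¹ ^ (-(u₀ + 2))) (Filter.Eventually.of_forall fun l => ?_)
    rw [← Real.rpow_mul (by positivity), mul_div_cancel₀ _ hη.ne', div_eq_mul_inv,
      Real.mul_rpow (by positivity) (by positivity), Real.norm_of_nonneg (by positivity),
      Real.norm_of_nonneg (by positivity), mul_comm]
  have h6 := h2.mul (h1.trans h5)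
  refine summable_of_isBigO_nat (g := fun l : ℕ => (l : ℝ) ^ (-2 : ℝ))
    (Real.summable_nat_rpow.2 (by norm_num)) (h6.congr' ?_ ?_)
  · exact Filter.Eventually.of_forall fun l => rfl
  · filter_upwards [Filter.eventually_ge_atTop 1] with l hl
    have hl' : (0 : ℝ) < l := by exact_mod_cast hl
    rw [← Real.rpow_add hl']
    congr 1
    ring

/-- The total weight of the edges at a point. The weights `exp (-a * ⌊f u⌋ ^ η / k)` decay on the
scale `k ^ (1 / η)`, and a ball of this radius has of the order of `k ^ (u₀ / η)` points; hence
`V` is cut into shells whose width is this scale. -/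
theorem exists_sum_exp_floor_le (c₀ : ℝ) {a u₀ η : ℝ} (hc₀ : 1 ≤ c₀) (ha : 0 < a)
    (hη : 0 < η) :
    ∃ c₁ : ℝ, 1 ≤ c₁ ∧ ∀ (V : Type*) [Fintype V] (f : V → ℝ), (∀ u, 0 ≤ f u) →
      (∀ s : ℝ, 1 ≤ s → ((Set.ncard {u : V | f u ≤ s} : ℕ) : ℝ) ≤ c₀ * s ^ u₀) →
      ∀ k : ℕ, 1 ≤ k →
        ∑ u, Real.exp (-a * (⌊f u⌋₊ : ℝ) ^ η / k) ≤ c₁ * (k : ℝ) ^ (u₀ / η) := by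
  classical
  set ψ : ℕ → ℝ := fun l => ((l : ℝ) + 1) ^ u₀ * Real.exp (-a * ((l : ℝ) / 2) ^ η) with hψ
  have hsum : Summable ψ := summable_rpow_mul_exp_neg_rpow ha hη
  have hψ0 : ∀ l, 0 ≤ ψ l := fun l => by positivity
  refine ⟨max 1 (c₀ * ∑' l, ψ l), le_max_left _ _, fun V _ f hf hball k hk => ?_⟩
  have hk1 : (1 : ℝ) ≤ k := by exact_mod_cast hk
  have hk0 : (0 : ℝ) < k := by linarith
  -- the length scale on which the weights decay
  set r : ℝ := (k : ℝ) ^ (1 / η) with hr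
  have hr1 : 1 ≤ r := Real.one_le_rpow hk1 (by positivity)
  have hr0 : 0 < r := by linarith
  have hrη : r ^ η = k := by
    rw [hr, ← Real.rpow_mul hk0.le, one_div, inv_mul_cancel₀ hη.ne', Real.rpow_one]
  have hru : r ^ u₀ = (k : ℝ) ^ (u₀ / η) := by
    rw [hr, ← Real.rpow_mul hk0.le]; congr 1; ring
  have hterm : ∀ u, Real.exp (-a * (⌊f u⌋₊ : ℝ) ^ η / k) ≤
      Real.exp (-a * ((⌊f u / r⌋₊ : ℝ) / 2) ^ η) := by
    intro u
    refine Real.exp_le_exp.2 ?_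
    rw [mul_div_assoc]
    refine mul_le_mul_of_nonpos_left ?_ (by linarith)
    rw [le_div_iff₀ hk0, ← hrη, ← Real.mul_rpow (by positivity) hr0.le]
    refine Real.rpow_le_rpow (by positivity) ?_ hη.le
    rcases Nat.eq_zero_or_pos ⌊f u / r⌋₊ with h0 | h0
    · rw [h0]; simp
    · have h1 : (⌊f u / r⌋₊ : ℝ) * r ≤ f u :=
        (le_div_iff₀ hr0).1 (Nat.floor_le (div_nonneg (hf u) hr0.le))
      have h2 : (1 : ℝ) ≤ ⌊f u / r⌋₊ := by exact_mod_cast h0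
      have h3 : 1 ≤ f u := by nlinarith
      have h4 : f u < ⌊f u⌋₊ + 1 := Nat.lt_floor_add_one _
      have h5 : (1 : ℝ) ≤ ⌊f u⌋₊ := by exact_mod_cast Nat.one_le_floor_iff _ |>.2 h3
      nlinarith
  set T : Finset ℕ := Finset.univ.image fun u => ⌊f u / r⌋₊ with hT
  calc ∑ u, Real.exp (-a * (⌊f u⌋₊ : ℝ) ^ η / k)
      ≤ ∑ u, Real.exp (-a * ((⌊f u / r⌋₊ : ℝ) / 2) ^ η) := Finset.sum_le_sum fun u _ => hterm u
    _ = ∑ l ∈ T, ((Finset.univ.filter fun u => ⌊f u / r⌋₊ = l).card : ℝ) *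
          Real.exp (-a * ((l : ℝ) / 2) ^ η) := by
        rw [← Finset.sum_fiberwise_of_maps_to (t := T) (g := fun u => ⌊f u / r⌋₊)
          fun u _ => Finset.mem_image_of_mem _ (Finset.mem_univ u)]
        refine Finset.sum_congr rfl fun l _ => ?_
        rw [← nsmul_eq_mul, ← Finset.sum_const]
        refine Finset.sum_congr rfl fun u hu => ?_
        rw [(Finset.mem_filter.1 hu).2]
    _ ≤ ∑ l ∈ T, c₀ * r ^ u₀ * ψ l := by
        refine Finset.sum_le_sum fun l _ => ?_
        have h1 : ((Finset.univ.filter fun u => ⌊f u / r⌋₊ = l).card : ℝ) ≤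
            c₀ * (((l : ℝ) + 1) * r) ^ u₀ := by
          refine le_trans ?_ (hball (((l : ℝ) + 1) * r) ?_)
          · rw [← Set.ncard_coe_finset]
            refine Nat.cast_le.2 (Set.ncard_le_ncard ?_ (Set.toFinite _))
            intro u hu
            simp only [Finset.coe_filter, Finset.mem_univ, true_and, Set.mem_ofPred_eq] at hu ⊢
            have := Nat.lt_floor_add_one (f u / r)
            rw [hu, div_lt_iff₀ hr0] at this
            exact this.le
          · have : (0 : ℝ) ≤ l := Nat.cast_nonneg l
            nlinarith
        rw [Real.mul_rpow (by positivity) hr0.le] at h1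
        calc _ ≤ c₀ * (((l : ℝ) + 1) ^ u₀ * r ^ u₀) * Real.exp (-a * ((l : ℝ) / 2) ^ η) :=
              mul_le_mul_of_nonneg_right h1 (Real.exp_pos _).le
          _ = _ := by rw [hψ]; ring
    _ = r ^ u₀ * (c₀ * ∑ l ∈ T, ψ l) := by rw [← Finset.mul_sum]; ring
    _ ≤ r ^ u₀ * max 1 (c₀ * ∑' l, ψ l) := by
        refine mul_le_mul_of_nonneg_left (le_max_of_le_right ?_) (by positivity)
        exact mul_le_mul_of_nonneg_left (hsum.sum_le_tsum T fun l _ => hψ0 l) (by linarith)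
    _ = _ := by rw [hru, mul_comm]

end

/-! ### Mixing fields -/

section

variable {Ω : Type*} [MeasurableSpace Ω] {P : Measure Ω} [IsProbabilityMeasure P]
variable {V : Type*}

omit [IsProbabilityMeasure P] in
theorem mixedMoment_const_mul {ι : Type*} (X : V → Ω → ℝ) (c : ℝ) (w : ι → V) (B : Finset ι) :
    mixedMoment P (fun v ω => c * X v ω) w B = c ^ B.card * mixedMoment P X w B := by
  unfold mixedMoment
  simp only [Finset.prod_mul_distrib, Finset.prod_const, integral_const_mul]

theorem abs_mixedMoment_le {ι : Type*} {X : V → Ω → ℝ} {M : ℝ} (hM : 0 < M) {k : ℕ}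
    (hm : ∀ v, AEStronglyMeasurable (X v) P) (hX : ∀ v, eLpNorm (X v) k P ≤ ENNReal.ofReal M)
    (w : ι → V) {B : Finset ι} (hB : B.card ≤ k) : |mixedMoment P X w B| ≤ M ^ B.card := by
  have h1 : |mixedMoment P (fun v ω => M⁻¹ * X v ω) w B| ≤ 1 := by
    refine abs_integral_prod_le_one B (f := fun i ω => M⁻¹ * X (w i) ω)
      (fun i => (hm (w i)).const_mul M⁻¹) hB fun i => ?_
    have h2 := eLpNorm_const_smul (μ := P) M⁻¹ (X (w i)) k
    have h3 : (M⁻¹ • X (w i)) = fun ω => M⁻¹ * X (w i) ω := rfl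
    rw [h3] at h2
    rw [h2, Real.enorm_of_nonneg (by positivity), ENNReal.ofReal_inv_of_pos hM]
    calc _ ≤ (ENNReal.ofReal M)⁻¹ * ENNReal.ofReal M := mul_le_mul_right (hX _) _
      _ = 1 := ENNReal.inv_mul_cancel (by simpa using hM) ENNReal.ofReal_ne_top
  rw [mixedMoment_const_mul, abs_mul, abs_of_pos (by positivity), inv_pow,
    inv_mul_le_iff₀ (by positivity), mul_one] at h1
  exact h1

variable [Fintype V] {ρ : V → V → ℝ} {X : V → Ω → ℝ} {ϱ : V → ℝ≥0∞ → ℝ≥0∞} {δ : ℝ≥0∞}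
  {γ : ℝ → ℕ → ℝ≥0}

theorem le_maxBound (ϱ : V → ℝ≥0∞ → ℝ≥0∞) (q : ℝ≥0∞) (v : V) : ϱ v q ≤ maxBound ϱ q :=
  Finset.le_sup (f := fun v => ϱ v q) (Finset.mem_univ v)

omit [IsProbabilityMeasure P] in
/-- The mixing condition for two index sets `C` and `D`, with the prefactor `card (C ∪ D) - 1` and
the factor `k` from `γ ≤ k * gammaTilde` absorbed in `k ^ 2`. -/
theorem abs_mixedMoment_union_sub_le {ι : Type*} [DecidableEq ι] (H : IsMixingField P ρ X ϱ δ γ)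
    {a η d M : ℝ} (hd : 1 ≤ d) (hM : 0 < M) {k : ℕ} (hk : 1 ≤ k)
    (hγ : ∀ m : ℕ, 1 ≤ m → (gammaTilde γ m k : ℝ) ≤ d * Real.exp (-a * (m : ℝ) ^ η))
    (hb : maxBound ϱ ((1 + δ) * k) ≤ ENNReal.ofReal M) (w : ι → V) {h : ℕ} (hh : 1 ≤ h)
    {C D : Finset ι} (hC : C.Nonempty) (hD : D.Nonempty) (hCD : Disjoint C D)
    (hcard : (C ∪ D).card ≤ k) (hsep : ∀ x ∈ C, ∀ y ∈ D, (h : ℝ) ≤ ρ (w x) (w y)) :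
    |mixedMoment P X w (C ∪ D) - mixedMoment P X w C * mixedMoment P X w D| ≤
      (k : ℝ) ^ 2 * d * Real.exp (-a * (h : ℝ) ^ η) * M ^ (C ∪ D).card := by
  have hcu := Finset.card_union_of_disjoint hCD
  have h1 := H.mixing k h 2 ![C.val.map w, D.val.map w] hk (by exact_mod_cast hh) (by norm_num)
    (by
      intro j
      fin_cases j
      · simpa using hC.ne_empty
      · simpa using hD.ne_empty)
    (by
      intro i j hij u hu v hv
      fin_cases i <;> fin_cases j
      · exact absurd rfl hij
      · simp only [Fin.zero_eta, Matrix.cons_val_zero, Fin.mk_one, Matrix.cons_val_one,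
          Multiset.mem_map, Finset.mem_val] at hu hv
        obtain ⟨x, hx, rfl⟩ := hu
        obtain ⟨y, hy, rfl⟩ := hv
        exact hsep x hx y hy
      · simp only [Fin.zero_eta, Matrix.cons_val_zero, Fin.mk_one, Matrix.cons_val_one,
          Multiset.mem_map, Finset.mem_val] at hu hv
        obtain ⟨x, hx, rfl⟩ := hu
        obtain ⟨y, hy, rfl⟩ := hv
        rw [H.rho_symm]
        exact hsep y hy x hx
      · exact absurd rfl hij)
    (by simpa [Fin.sum_univ_two, ← hcu] using hcard)
  simp only [Fin.prod_univ_two, Fin.sum_univ_two, Matrix.cons_val_zero, Matrix.cons_val_one,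
    Multiset.map_map, Multiset.card_map, Finset.card_val, Function.comp_def] at h1
  rw [← hcu] at h1
  have hprod : ∀ ω, (C.val.map fun x => X (w x) ω).prod * (D.val.map fun x => X (w x) ω).prod =
      ∏ i ∈ C ∪ D, X (w i) ω := fun ω => by
    rw [Finset.prod_union hCD]; rfl
  simp only [hprod] at h1
  have hb' : ∀ v, ϱ v ((1 + δ) * k) ≤ ENNReal.ofReal M := fun v => (le_maxBound ϱ _ v).trans hb
  have h2 : (C.val.map fun x => ϱ (w x) ((1 + δ) * k)).prod *
      (D.val.map fun x => ϱ (w x) ((1 + δ) * k)).prod ≤ ENNReal.ofReal (M ^ (C ∪ D).card) := by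
    change (∏ x ∈ C, ϱ (w x) ((1 + δ) * k)) * (∏ x ∈ D, ϱ (w x) ((1 + δ) * k)) ≤ _
    rw [← Finset.prod_union hCD, ENNReal.ofReal_pow hM.le]
    exact Finset.prod_le_pow_card _ _ _ fun x _ => hb' _
  have hγk : (γ h k : ℝ) ≤ k * (d * Real.exp (-a * (h : ℝ) ^ η)) := by
    have h3 : γ h k / k ≤ gammaTilde γ h k :=
      Finset.le_sup (f := fun r : ℕ => γ h r / r) (Finset.mem_Icc.2 ⟨hk, le_rfl⟩)
    have h4 : (γ h k : ℝ) / k ≤ d * Real.exp (-a * (h : ℝ) ^ η) :=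
      le_trans (by exact_mod_cast h3) (hγ h hh)
    rwa [div_le_iff₀' (by exact_mod_cast hk)] at h4
  have h5 : (((C ∪ D).card - 1 : ℕ) : ℝ≥0∞) ≤ ENNReal.ofReal k := by
    rw [ENNReal.ofReal_natCast]
    exact_mod_cast (Nat.sub_le _ _).trans hcard
  have h6 : (γ h k : ℝ≥0∞) ≤ ENNReal.ofReal (k * (d * Real.exp (-a * (h : ℝ) ^ η))) := by
    rw [← ENNReal.ofReal_coe_nnreal]
    exact ENNReal.ofReal_le_ofReal hγk
  have h7 := h1.trans (mul_le_mul' (mul_le_mul' h5 h2) h6)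
  rw [← ENNReal.ofReal_mul (by positivity), ← ENNReal.ofReal_mul (by positivity),
    ENNReal.ofReal_le_ofReal_iff (by positivity)] at h7
  refine h7.trans (le_of_eq ?_)
  ring

/-- The variables are divided by `2 * M` instead of `M`: for two nonempty sets this makes the
trivial bound for `μ (C ∪ D) - μ C * μ D` at most `1`. -/
theorem weakFactor_mixedMoment (H : IsMixingField P ρ X ϱ δ γ)
    {a η d M : ℝ} (hη : 0 < η) (hd : 1 ≤ d) (hM : 0 < M) {k : ℕ} (hk : 1 ≤ k)
    (hγ : ∀ m : ℕ, 1 ≤ m → (gammaTilde γ m k : ℝ) ≤ d * Real.exp (-a * (m : ℝ) ^ η))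
    (hb₁ : maxBound ϱ k ≤ ENNReal.ofReal M) (hb₂ : maxBound ϱ ((1 + δ) * k) ≤ ENNReal.ofReal M)
    {ι : Type*} [DecidableEq ι] (w : ι → V) :
    WeakFactor (mixedMoment P (fun v ω => (2 * M)⁻¹ * X v ω) w)
      (fun i j => ⌊ρ (w i) (w j)⌋₊)
      (fun h => min 1 ((k : ℝ) ^ 2 * d * Real.exp (-a * (h : ℝ) ^ η))) k := by
  have hk1 : (1 : ℝ) ≤ k := by exact_mod_cast hk
  have hmom : ∀ B : Finset ι, B.card ≤ k →
      |mixedMoment P (fun v ω => (2 * M)⁻¹ * X v ω) w B| ≤ (1 / 2) ^ B.card := by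
    intro B hB
    have h1 := abs_mixedMoment_le hM (fun v => (H.memLp v 0).1)
      (fun v => ((H.norm_le v k (by exact_mod_cast hk)).trans (le_maxBound ϱ k v)).trans hb₁) w hB
    rw [mixedMoment_const_mul, abs_mul, abs_of_pos (by positivity)]
    calc _ ≤ ((2 * M)⁻¹) ^ B.card * M ^ B.card := mul_le_mul_of_nonneg_left h1 (by positivity)
      _ = (1 / 2) ^ B.card := by
        rw [← mul_pow]; congr 1; field_simp
  refine ⟨mixedMoment_empty _ _, fun B hB => (hmom B hB).trans
    (pow_le_one₀ (by norm_num) (by norm_num)), ?_, fun h => min_le_left _ _,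
    fun h => le_min zero_le_one (by positivity), fun h C D hh hCD hcard hsep => ?_⟩
  · rw [min_eq_left]
    simp only [Nat.cast_zero, Real.zero_rpow hη.ne', mul_zero, Real.exp_zero, mul_one]
    nlinarith [one_le_pow₀ hk1 (n := 2)]
  have hempty := mixedMoment_empty (P := P) (fun v ω => (2 * M)⁻¹ * X v ω) w
  rcases C.eq_empty_or_nonempty with rfl | hC
  · rw [hempty, Finset.empty_union, one_mul, sub_self, abs_zero]
    exact le_min zero_le_one (by positivity)
  rcases D.eq_empty_or_nonempty with rfl | hD
  · rw [hempty, Finset.union_empty, mul_one, sub_self, abs_zero]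
    exact le_min zero_le_one (by positivity)
  have hcu := Finset.card_union_of_disjoint hCD
  refine le_min ?_ ?_
  · have h1 := hmom _ hcard
    have h2 := hmom C ((Finset.card_le_card Finset.subset_union_left).trans hcard)
    have h3 := hmom D ((Finset.card_le_card Finset.subset_union_right).trans hcard)
    refine (abs_sub _ _).trans ?_
    rw [abs_mul]
    have hC1 : ((1 : ℝ) / 2) ^ C.card ≤ 1 / 2 :=
      pow_le_of_le_one (by norm_num) (by norm_num) hC.card_pos.ne'
    have hD1 : ((1 : ℝ) / 2) ^ D.card ≤ 1 :=
      pow_le_one₀ (by norm_num) (by norm_num)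
    have h4 : ((1 : ℝ) / 2) ^ (C ∪ D).card ≤ 1 / 2 :=
      pow_le_of_le_one (by norm_num) (by norm_num) (by have := hC.card_pos; omega)
    have h5 := mul_le_mul (h2.trans hC1) (h3.trans hD1) (abs_nonneg _) (by norm_num)
    linarith
  · rw [mixedMoment_const_mul, mixedMoment_const_mul, mixedMoment_const_mul]
    have h1 := abs_mixedMoment_union_sub_le H hd hM hk hγ hb₂ w hh hC hD hCD hcard
      fun x hx y hy => (Nat.le_floor_iff (H.rho_nonneg _ _)).1 (hsep x hx y hy)
    have h2 : (2 * M)⁻¹ ^ (C ∪ D).card * mixedMoment P X w (C ∪ D) -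
        (2 * M)⁻¹ ^ C.card * mixedMoment P X w C * ((2 * M)⁻¹ ^ D.card * mixedMoment P X w D) =
        (2 * M)⁻¹ ^ (C ∪ D).card *
          (mixedMoment P X w (C ∪ D) - mixedMoment P X w C * mixedMoment P X w D) := by
      rw [hcu, pow_add]; ring
    rw [h2, abs_mul, abs_of_pos (by positivity)]
    calc _ ≤ (2 * M)⁻¹ ^ (C ∪ D).card *
          ((k : ℝ) ^ 2 * d * Real.exp (-a * (h : ℝ) ^ η) * M ^ (C ∪ D).card) :=
          mul_le_mul_of_nonneg_left h1 (by positivity)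
      _ = (1 / 2) ^ (C ∪ D).card * ((k : ℝ) ^ 2 * d * Real.exp (-a * (h : ℝ) ^ η)) := by
          have : ((1 : ℝ) / 2) = (2 * M)⁻¹ * M := by field_simp
          rw [this, mul_pow]; ring
      _ ≤ _ := mul_le_of_le_one_left (by positivity)
          (pow_le_one₀ (by norm_num) (by norm_num))

end

/-! ### The estimate with a common bound for the norms -/

section

theorem cumulant_zero_succ {Ω : Type*} [MeasurableSpace Ω] {P : Measure Ω} [IsProbabilityMeasure P]
    (n : ℕ) : cumulant P (fun _ => (0 : ℝ)) (n + 1) = 0 := by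
  have h := cumulant_const_mul (P := P) (W := fun _ => (0 : ℝ)) (fun k => memLp_const 0) 0 n
  simpa using h

theorem pow_self_le_exp_one_pow_mul_factorial (k : ℕ) :
    (k : ℝ) ^ k ≤ Real.exp 1 ^ k * k.factorial := by
  have h := Real.pow_div_factorial_le_exp (k : ℝ) (Nat.cast_nonneg k) k
  rwa [div_le_iff₀ (by positivity), ← Real.exp_one_pow] at h

/-- The estimate of the cumulants in terms of a common bound `M` for the norms. The edge weight is
the `k`-th root of `min 1 (k ^ 2 * d * exp (-a * h ^ η))`, so that the prefactor `k ^ 2 * d`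
appears only once in the product over the edges. -/
theorem exists_norm_cumulant_le (c₀ a u₀ η : ℝ) (hc₀ : 1 ≤ c₀) (ha : 0 < a) (hu₀ : 0 ≤ u₀)
    (hη : 0 < η) :
    ∃ c : ℝ, 0 < c ∧ ∀ (V : Type*) [Fintype V] (Ω : Type*) [MeasurableSpace Ω] (P : Measure Ω)
      [IsProbabilityMeasure P] (ρ : V → V → ℝ) (X : V → Ω → ℝ) (ϱ : V → ℝ≥0∞ → ℝ≥0∞)
      (δ : ℝ≥0∞) (γ : ℝ → ℕ → ℝ≥0) (d : ℝ),
      IsMixingField P ρ X ϱ δ γ →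
      (∀ (v : V) (s : ℝ), 1 ≤ s → ((Set.ncard {u : V | ρ u v ≤ s} : ℕ) : ℝ) ≤ c₀ * s ^ u₀) →
      1 ≤ d →
      (∀ m k : ℕ, 1 ≤ m → 1 ≤ k →
        (gammaTilde γ m k : ℝ) ≤ d * Real.exp (-a * (m : ℝ) ^ η)) →
      ∀ (k : ℕ) (M : ℝ), 1 ≤ k → 0 < M → maxBound ϱ k ≤ ENNReal.ofReal M →
        maxBound ϱ ((1 + δ) * k) ≤ ENNReal.ofReal M →
        ‖cumulant P (fun ω => ∑ v, X v ω) k‖ ≤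
          d ^ k * Fintype.card V * c ^ k * (k.factorial : ℝ) ^ (1 + u₀ / η) * M ^ k := by
  obtain ⟨c₁, hc₁, hK⟩ := exists_sum_exp_floor_le c₀ (u₀ := u₀) hc₀ ha hη
  refine ⟨2 * 2 * (4 * Real.exp 2) * (2 * Real.exp 2) * c₁ * Real.exp 1 ^ (u₀ / η),
    by positivity, ?_⟩
  intro V _ Ω _ P _ ρ X ϱ δ γ d H hball hd hγ k M hk hM hb₁ hb₂
  obtain ⟨n, rfl⟩ : ∃ n, k = n + 1 := ⟨k - 1, by omega⟩
  rcases isEmpty_or_nonempty V with hV | hV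
  · simp [cumulant_zero_succ]
  set k : ℕ := n + 1 with hkdef
  have hk1 : (1 : ℝ) ≤ k := by exact_mod_cast hk
  have hk0 : (0 : ℝ) < k := by linarith
  set ε : ℕ → ℝ := fun h => min 1 ((k : ℝ) ^ 2 * d * Real.exp (-a * (h : ℝ) ^ η)) with hε
  have hε0 : ∀ h, 0 ≤ ε h := fun h => le_min zero_le_one (by positivity)
  have hεanti : Antitone ε := by
    intro h h' hh
    refine min_le_min le_rfl (mul_le_mul_of_nonneg_left (Real.exp_le_exp.2 ?_) (by positivity))
    refine mul_le_mul_of_nonpos_left ?_ (by linarith)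
    exact Real.rpow_le_rpow (Nat.cast_nonneg _) (by exact_mod_cast hh) hη.le
  set e : ℕ → ℝ := fun h => ε h ^ ((k : ℝ)⁻¹) with he
  set B : ℝ := ((k : ℝ) ^ 2 * d) ^ ((k : ℝ)⁻¹) with hB
  set K : ℝ := B * (c₁ * (k : ℝ) ^ (u₀ / η)) with hKdef
  have hB0 : 0 ≤ B := by positivity
  have hB1 : 1 ≤ B := Real.one_le_rpow
    (by nlinarith [one_le_pow₀ hk1 (n := 2)]) (by positivity)
  have hBk : B ^ k = (k : ℝ) ^ 2 * d := Real.rpow_inv_natCast_pow (by positivity) (by omega)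
  have hKbound : ∀ u, ∑ u', e ⌊ρ u u'⌋₊ ≤ K := by
    intro u
    have h1 := hK V (fun u' => ρ u u') (fun u' => H.rho_nonneg u u')
      (fun s hs => by
        have := hball u s hs
        simpa only [H.rho_symm _ u] using this) k hk
    refine le_trans ?_ (mul_le_mul_of_nonneg_left h1 hB0)
    rw [Finset.mul_sum]
    refine Finset.sum_le_sum fun u' _ => ?_
    calc e ⌊ρ u u'⌋₊ ≤ ((k : ℝ) ^ 2 * d * Real.exp (-a * (⌊ρ u u'⌋₊ : ℝ) ^ η)) ^ ((k : ℝ)⁻¹) :=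
          Real.rpow_le_rpow (hε0 _) (min_le_right _ _) (by positivity)
      _ = _ := by
          rw [Real.mul_rpow (by positivity) (Real.exp_pos _).le, ← Real.exp_mul, div_eq_mul_inv]
  have hmain := norm_cumulant_le_of_weakFactor (P := P) (X := fun v ω => (2 * M)⁻¹ * X v ω)
    (fun v j => (H.memLp v j).const_mul _) n (R := fun u u' => ⌊ρ u u'⌋₊) (ε := ε) (e := e)
    (fun w => weakFactor_mixedMoment H hη hd hM hk (fun m hm => hγ m k hm hk) hb₁ hb₂ w)
    (fun h => Real.rpow_nonneg (hε0 h) _)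
    (fun h => Real.rpow_le_one (hε0 h) (min_le_left _ _) (by positivity))
    (fun h h' hh => Real.rpow_le_rpow (hε0 _) (hεanti hh) (by positivity))
    (fun h => (Real.rpow_inv_natCast_pow (hε0 h) (by omega)).ge)
    (by positivity) hKbound
  have hWL : ∀ j : ℕ, MemLp (fun ω => ∑ u, X u ω) j P := fun j =>
    memLp_finsetSum _ fun u _ => H.memLp u j
  -- cumulants are homogeneous, which undoes the normalisation of the variables
  have hscale := cumulant_const_mul (P := P) hWL (2 * M)⁻¹ n
  simp only [Finset.mul_sum] at hscale
  rw [hscale, norm_mul, norm_pow, Complex.norm_real, Real.norm_of_nonneg (by positivity),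
    inv_pow, inv_mul_le_iff₀ (by positivity)] at hmain
  refine hmain.trans ?_
  -- collect the constants
  have hfac1 : (1 : ℝ) ≤ k.factorial := by exact_mod_cast Nat.factorial_pos k
  have hKn : K ^ n ≤ (k : ℝ) ^ 2 * d * (c₁ ^ k *
      (Real.exp 1 ^ (u₀ / η)) ^ k * (k.factorial : ℝ) ^ (u₀ / η)) := by
    have hp : 0 ≤ u₀ / η := by positivity
    have hk2 : 1 ≤ (k : ℝ) ^ (u₀ / η) := Real.one_le_rpow hk1 hp
    have h1 : K ^ n ≤ K ^ k := by
      refine pow_le_pow_right₀ ?_ (by omega)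
      exact one_le_mul_of_one_le_of_one_le hB1 (one_le_mul_of_one_le_of_one_le hc₁ hk2)
    refine h1.trans ?_
    rw [hKdef, mul_pow, hBk, mul_pow, mul_assoc (c₁ ^ k)]
    refine mul_le_mul_of_nonneg_left (mul_le_mul_of_nonneg_left ?_ (by positivity))
      (by positivity)
    have h2 := Real.rpow_le_rpow (by positivity) (pow_self_le_exp_one_pow_mul_factorial k) hp
    rw [Real.mul_rpow (by positivity) (by positivity)] at h2
    rw [← Real.rpow_natCast, ← Real.rpow_natCast, ← Real.rpow_mul (by positivity),
      ← Real.rpow_mul (by positivity), mul_comm (u₀ / η), Real.rpow_mul (by positivity),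
      Real.rpow_mul (by positivity), Real.rpow_natCast, Real.rpow_natCast]
    exact h2
  have hkfac : (n.factorial : ℝ) * (k : ℝ) ^ 2 ≤ 2 ^ k * k.factorial := by
    have h1 : (k.factorial : ℝ) = k * n.factorial := by
      rw [hkdef, Nat.factorial_succ]; push_cast; ring
    have h2 : (k : ℝ) ≤ 2 ^ k := by exact_mod_cast Nat.lt_two_pow_self.le
    calc (n.factorial : ℝ) * (k : ℝ) ^ 2 = k * (k * n.factorial) := by ring
      _ ≤ 2 ^ k * (k * n.factorial) := mul_le_mul_of_nonneg_right h2 (by positivity)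
      _ = _ := by rw [h1]
  have hdk : d ≤ d ^ k := le_self_pow₀ hd (by omega)
  have hE : (1 : ℝ) ≤ Real.exp 2 := Real.one_le_exp (by norm_num)
  have hE4 : (4 * Real.exp 2) ^ n ≤ (4 * Real.exp 2) ^ k :=
    pow_le_pow_right₀ (by linarith) (by omega)
  have hE2 : 2 * Real.exp 2 ≤ (2 * Real.exp 2) ^ k := le_self_pow₀ (by linarith) (by omega)
  rw [Real.rpow_add (by linarith), Real.rpow_one, mul_pow (4 * Real.exp 2)]
  calc (2 * M) ^ (n + 1) * (Fintype.card V * (n.factorial * ((4 * Real.exp 2) ^ n * K ^ n) *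
        (2 * Real.exp 2)))
      ≤ (2 * M) ^ (n + 1) * (Fintype.card V * (n.factorial * ((4 * Real.exp 2) ^ k *
          ((k : ℝ) ^ 2 * d * (c₁ ^ k * (Real.exp 1 ^ (u₀ / η)) ^ k *
            (k.factorial : ℝ) ^ (u₀ / η)))) * (2 * Real.exp 2) ^ k)) := by
        gcongr
    _ = (2 * M) ^ k * (Fintype.card V * (4 * Real.exp 2) ^ k * (2 * Real.exp 2) ^ k * c₁ ^ k *
          (Real.exp 1 ^ (u₀ / η)) ^ k * (k.factorial : ℝ) ^ (u₀ / η)) *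
          (d * (n.factorial * (k : ℝ) ^ 2)) := by
        rw [← hkdef]; ring
    _ ≤ (2 * M) ^ k * (Fintype.card V * (4 * Real.exp 2) ^ k * (2 * Real.exp 2) ^ k * c₁ ^ k *
          (Real.exp 1 ^ (u₀ / η)) ^ k * (k.factorial : ℝ) ^ (u₀ / η)) *
          (d ^ k * (2 ^ k * k.factorial)) := by
        gcongr
    _ = _ := by
        simp only [mul_pow]
        ring

end

/-! ### Stirling bounds for the Gamma function -/

section

theorem factorial_le_stirling {n : ℕ} (hn : 1 ≤ n) :
    (n.factorial : ℝ) ≤ Real.exp 1 * √n * (n / Real.exp 1) ^ n := by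
  obtain ⟨m, rfl⟩ : ∃ m, n = m + 1 := ⟨n - 1, by omega⟩
  have h1 : Stirling.stirlingSeq (m + 1) ≤ Stirling.stirlingSeq 1 :=
    Stirling.stirlingSeq'_antitone (Nat.zero_le m)
  rw [Stirling.stirlingSeq_one, Stirling.stirlingSeq, div_le_iff₀ (by positivity)] at h1
  refine h1.trans (le_of_eq ?_)
  rw [Real.sqrt_mul (by norm_num)]
  field_simp

/-- Stirling's upper bound at a real argument, from the one for factorials and the log-convexity
of the Gamma function between `⌊q⌋₊ + 1` and `⌊q⌋₊ + 2`. -/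
theorem Gamma_add_one_le_stirling {q : ℝ} (hq : 1 ≤ q) :
    Real.Gamma (q + 1) ≤ 2 * Real.exp 2 * √q * (q / Real.exp 1) ^ q := by
  have hq0 : 0 < q := by linarith
  set n : ℕ := ⌊q⌋₊ with hn
  have hn1 : 1 ≤ n := (Nat.one_le_floor_iff _).2 hq
  have hn1' : (1 : ℝ) ≤ n := by exact_mod_cast hn1
  have hnq : (n : ℝ) ≤ q := Nat.floor_le hq0.le
  have hqn : q < n + 1 := Nat.lt_floor_add_one q
  set s : ℝ := q - n with hs
  have hs0 : 0 ≤ s := by linarith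
  have hs1 : s < 1 := by linarith
  have h1 : Real.Gamma (q + 1) ≤ n.factorial * ((n : ℝ) + 1) ^ s := by
    rcases hs0.eq_or_lt with h0 | h0
    · have hqn' : q = n := by linarith
      rw [← h0, Real.rpow_zero, mul_one, hqn', Real.Gamma_nat_eq_factorial]
    · have h2 := Real.Gamma_mul_add_mul_le_rpow_Gamma_mul_rpow_Gamma
        (s := (n : ℝ) + 1) (t := (n : ℝ) + 1 + 1) (a := 1 - s) (b := s)
        (by positivity) (by positivity) (by linarith) h0 (by ring)
      have h3 : (1 - s) * ((n : ℝ) + 1) + s * (n + 1 + 1) = q + 1 := by rw [hs]; ring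
      rw [h3, Real.Gamma_add_one (s := (n : ℝ) + 1) (by positivity),
        Real.Gamma_nat_eq_factorial, Real.mul_rpow (by positivity) (by positivity)] at h2
      refine h2.trans (le_of_eq ?_)
      have h4 : (n.factorial : ℝ) ^ (1 - s) * (n.factorial : ℝ) ^ s = n.factorial := by
        rw [← Real.rpow_add (by positivity)]; simp
      linear_combination ((n : ℝ) + 1) ^ s * h4
  have h5 : ((n : ℝ) + 1) ^ s ≤ 2 * q ^ s := by
    calc ((n : ℝ) + 1) ^ s ≤ (2 * q) ^ s :=
          Real.rpow_le_rpow (by positivity) (by linarith) hs0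
      _ = 2 ^ s * q ^ s := Real.mul_rpow (by norm_num) hq0.le
      _ ≤ 2 * q ^ s := by
          refine mul_le_mul_of_nonneg_right ?_ (by positivity)
          calc (2 : ℝ) ^ s ≤ 2 ^ (1 : ℝ) :=
                Real.rpow_le_rpow_of_exponent_le (by norm_num) hs1.le
            _ = 2 := Real.rpow_one 2
  have h6 : ((n : ℝ) / Real.exp 1) ^ n ≤ Real.exp s * (q ^ (n : ℝ) * Real.exp (-q)) := by
    rw [div_pow, Real.exp_one_pow, Real.rpow_natCast]
    have : Real.exp s * (q ^ n * Real.exp (-q)) = q ^ n / Real.exp n := by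
      rw [hs, Real.exp_sub, Real.exp_neg]
      field_simp
    rw [this]
    gcongr
  have h7 : Real.exp s ≤ Real.exp 1 := Real.exp_le_exp.2 hs1.le
  have h8 : (q / Real.exp 1) ^ q = q ^ (n : ℝ) * q ^ s * Real.exp (-q) := by
    rw [Real.div_rpow hq0.le (Real.exp_pos 1).le, ← Real.rpow_add hq0, Real.exp_one_rpow,
      Real.exp_neg, div_eq_mul_inv]
    congr 2
    rw [hs]; ring
  have h9 : Real.exp 2 = Real.exp 1 * Real.exp 1 := by rw [← Real.exp_add]; norm_num
  calc Real.Gamma (q + 1) ≤ n.factorial * ((n : ℝ) + 1) ^ s := h1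
    _ ≤ (Real.exp 1 * √n * (n / Real.exp 1) ^ n) * (2 * q ^ s) :=
        mul_le_mul (factorial_le_stirling hn1) h5 (by positivity) (by positivity)
    _ ≤ (Real.exp 1 * √q * (Real.exp 1 * (q ^ (n : ℝ) * Real.exp (-q)))) * (2 * q ^ s) := by
        gcongr
        exact h6.trans (mul_le_mul_of_nonneg_right h7 (by positivity))
    _ = _ := by rw [h8, h9]; ring

/-- The powers of `2 * π * k` in Stirling's formula for `k! ^ x` absorb the factor `√(x * k)`, as
`x * k ≤ exp (x - 1) * k ≤ (2 * π * k) ^ x`; so the constant does not depend on `x`. -/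
theorem Gamma_mul_add_one_le {x : ℝ} (hx : 1 ≤ x) {k : ℕ} (hk : 1 ≤ k) :
    Real.Gamma (x * k + 1) ≤ 2 * Real.exp 2 * x ^ (x * k) * (k.factorial : ℝ) ^ x := by
  have hk1 : (1 : ℝ) ≤ k := by exact_mod_cast hk
  have hx0 : 0 < x := by linarith
  have hk0 : (0 : ℝ) < k := by linarith
  have h1 := Gamma_add_one_le_stirling (q := x * k) (by nlinarith)
  have h2 := Real.rpow_le_rpow (by positivity) (Stirling.le_factorial_stirling k) hx0.le
  have h3 : √(x * k) ≤ √(2 * Real.pi * k) ^ x := by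
    rw [Real.sqrt_eq_rpow (2 * Real.pi * k), ← Real.rpow_mul (by positivity), mul_comm (1 / 2) x,
      Real.rpow_mul (by positivity), ← Real.sqrt_eq_rpow]
    refine Real.sqrt_le_sqrt ?_
    have h4 : Real.exp 1 ≤ 2 * Real.pi * k := by
      have := Real.exp_one_lt_d9
      have := Real.pi_gt_three
      nlinarith
    have h5 : k ≤ 2 * Real.pi * k := by
      have := Real.pi_gt_three
      nlinarith
    calc x * k ≤ Real.exp (x - 1) * k := by
          refine mul_le_mul_of_nonneg_right ?_ hk0.le
          have := Real.add_one_le_exp (x - 1)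
          linarith
      _ ≤ (2 * Real.pi * k) ^ (x - 1) * (2 * Real.pi * k) := by
          refine mul_le_mul ?_ h5 hk0.le (by positivity)
          rw [← Real.exp_one_rpow]
          exact Real.rpow_le_rpow (Real.exp_pos 1).le h4 (by linarith)
      _ = (2 * Real.pi * k) ^ x := by
          rw [← Real.rpow_add_one (by positivity)]; congr 1; ring
  refine h1.trans ?_
  have h6 : (x * k / Real.exp 1) ^ (x * k) = x ^ (x * k) * ((k / Real.exp 1) ^ k) ^ x := by
    rw [mul_div_assoc, Real.mul_rpow hx0.le (by positivity), ← Real.rpow_natCast (k / Real.exp 1),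
      ← Real.rpow_mul (by positivity), mul_comm (k : ℝ) x]
  rw [h6]
  rw [Real.mul_rpow (by positivity) (by positivity)] at h2
  calc 2 * Real.exp 2 * √(x * k) * (x ^ (x * k) * ((k / Real.exp 1) ^ k) ^ x)
      ≤ 2 * Real.exp 2 * √(2 * Real.pi * k) ^ x *
          (x ^ (x * k) * ((k / Real.exp 1) ^ k) ^ x) := by gcongr
    _ = 2 * Real.exp 2 * x ^ (x * k) *
          (√(2 * Real.pi * k) ^ x * ((k / Real.exp 1) ^ k) ^ x) := by ring
    _ ≤ _ := by gcongr

end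

/-! ### The bounds `maxBound` -/

section

variable {V Ω : Type*} [MeasurableSpace Ω] {P : Measure Ω}
  {ρ : V → V → ℝ} {X : V → Ω → ℝ} {ϱ : V → ℝ≥0∞ → ℝ≥0∞} {δ : ℝ≥0∞} {γ : ℝ → ℕ → ℝ≥0}

theorem isMixingField_top [IsProbabilityMeasure P] (H : IsMixingField P ρ X ϱ ⊤ γ) :
    IsMixingField P ρ X (fun v _ => ϱ v ⊤) ⊤ γ where
  rho_nonneg := H.rho_nonneg
  rho_self := H.rho_self
  rho_symm := H.rho_symm
  memLp := H.memLp
  centered := H.centered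
  bound_pos v _ _ := H.bound_pos v ⊤ ENNReal.zero_lt_top
  norm_le v _ _ := (eLpNorm_le_eLpNorm_of_exponent_le le_top (H.memLp v 0).1).trans
    (H.norm_le v ⊤ ENNReal.zero_lt_top)
  delta_pos := H.delta_pos
  mixing k b n A hk hb hn hA hsep hcard := by
    have h := H.mixing k b n A hk hb hn hA hsep hcard
    have htop : (1 + (⊤ : ℝ≥0∞)) * k = ⊤ := by
      rw [add_top, ENNReal.top_mul (by exact_mod_cast (by omega : k ≠ 0))]
    rwa [htop] at h

/-- Passage from estimates with a finite common bound `M` to the maximal bounds in `[0, ∞]`, one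
of which may be infinite. -/
theorem ofReal_le_mul_maxBound_pow_add [Fintype V] (hpos : ∀ v t, 0 < t → 0 < ϱ v t) {k : ℕ}
    (hk : 1 ≤ k) {z A : ℝ} (hA : 0 ≤ A) (hAe : IsEmpty V → A = 0)
    (hAV : Nonempty V → 0 < A) (q : ℝ≥0∞)
    (hz : ∀ M : ℝ, 0 < M → maxBound ϱ k ≤ ENNReal.ofReal M → maxBound ϱ q ≤ ENNReal.ofReal M →
      z ≤ A * M ^ k) :
    ENNReal.ofReal z ≤ ENNReal.ofReal A * (maxBound ϱ k ^ k + maxBound ϱ q ^ k) := by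
  have hk0 : k ≠ 0 := by omega
  rcases isEmpty_or_nonempty V with hV | ⟨⟨v⟩⟩
  · have h0 := hz 1 one_pos (by simp [maxBound]) (by simp [maxBound])
    rw [hAe hV, zero_mul] at h0
    simp [ENNReal.ofReal_of_nonpos h0]
  · have hA' : ENNReal.ofReal A ≠ 0 := by simpa using hAV ⟨v⟩
    set m := max (maxBound ϱ k) (maxBound ϱ q) with hm
    have hmle : m ^ k ≤ maxBound ϱ k ^ k + maxBound ϱ q ^ k := by
      rcases max_choice (maxBound ϱ k) (maxBound ϱ q) with h | h
      · rw [hm, h]; exact le_self_add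
      · rw [hm, h]; exact le_add_self
    refine le_trans ?_ (mul_le_mul_right hmle _)
    by_cases htop : m = ⊤
    · rw [htop, ENNReal.top_pow hk0, ENNReal.mul_top hA']
      exact le_top
    · have hm0 : 0 < m := lt_of_lt_of_le (hpos v k (by exact_mod_cast hk))
        ((le_maxBound ϱ k v).trans (le_max_left _ _))
      have hM : ENNReal.ofReal m.toReal = m := ENNReal.ofReal_toReal htop
      have h1 := hz m.toReal (ENNReal.toReal_pos hm0.ne' htop)
        (by rw [hM]; exact le_max_left _ _) (by rw [hM]; exact le_max_right _ _)
      calc ENNReal.ofReal z ≤ ENNReal.ofReal (A * m.toReal ^ k) := ENNReal.ofReal_le_ofReal h1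
        _ = _ := by rw [ENNReal.ofReal_mul hA, ENNReal.ofReal_pow ENNReal.toReal_nonneg, hM]

theorem maxBound_le_of_rpow_le [Fintype V] {q M G θ : ℝ} (hq : 0 < q) (hM : 0 < M) (hG : 0 < G)
    (h : ∀ v, ϱ v (ENNReal.ofReal q) ^ q ≤ ENNReal.ofReal (M ^ q * G ^ θ)) :
    maxBound ϱ (ENNReal.ofReal q) ≤ ENNReal.ofReal (M * G ^ (θ / q)) := by
  refine Finset.sup_le fun v _ => ?_
  have h1 : ENNReal.ofReal (M ^ q * G ^ θ) = ENNReal.ofReal (M * G ^ (θ / q)) ^ q := by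
    rw [ENNReal.ofReal_rpow_of_pos (by positivity), Real.mul_rpow hM.le (by positivity),
      ← Real.rpow_mul hG.le, div_mul_cancel₀ _ hq.ne']
  rw [← ENNReal.rpow_le_rpow_iff hq, ← h1]
  exact h v

end

end MixingCumulant

open MixingCumulant in
theorem mainTheorem7 :
    ∃ C : ℝ, 0 < C ∧
    ∀ c₀ a u₀ η : ℝ, 1 ≤ c₀ → 0 < a → 0 ≤ u₀ → 0 < η →
    ∃ c : ℝ, 0 < c ∧
    ∀ (V : Type*) [Fintype V] (Ω : Type*) [MeasurableSpace Ω] (P : Measure Ω)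
      [IsProbabilityMeasure P] (ρ : V → V → ℝ) (X : V → Ω → ℝ) (ϱ : V → ℝ≥0∞ → ℝ≥0∞)
      (δ : ℝ≥0∞) (γ : ℝ → ℕ → ℝ≥0) (d : ℝ),
      IsMixingField P ρ X ϱ δ γ →
      (∀ (v : V) (s : ℝ), 1 ≤ s → ((Set.ncard {u : V | ρ u v ≤ s} : ℕ) : ℝ) ≤ c₀ * s ^ u₀) →
      1 ≤ d →
      (∀ m k : ℕ, 1 ≤ m → 1 ≤ k →
        (gammaTilde γ m k : ℝ) ≤ d * Real.exp (-a * (m : ℝ) ^ η)) →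
      -- the general estimate
      (∀ k : ℕ, 2 ≤ k →
        ENNReal.ofReal ‖cumulant P (fun ω => ∑ v, X v ω) k‖ ≤
          ENNReal.ofReal (d ^ k * Fintype.card V * c ^ k * (k.factorial : ℝ) ^ (1 + u₀ / η)) *
            (maxBound ϱ k ^ k + maxBound ϱ ((1 + δ) * k) ^ k)) ∧
      -- bounded summands and `δ = ∞`
      ((∀ v, ∃ B : ℝ, ∀ᵐ ω ∂P, |X v ω| ≤ B) → δ = ⊤ →
        IsMixingField P ρ X (fun v _ => ϱ v ⊤) δ γ ∧
        ∀ k : ℕ, 2 ≤ k →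
          ENNReal.ofReal ‖cumulant P (fun ω => ∑ v, X v ω) k‖ ≤
            ENNReal.ofReal
              (2 * d ^ k * Fintype.card V * c ^ k * (k.factorial : ℝ) ^ (1 + u₀ / η)) *
              maxBound ϱ ⊤ ^ k) ∧
      -- moment growth and `δ < ∞`; here `q! = Γ(q + 1)`
      (δ < ⊤ → ∀ θ M : ℝ, 0 ≤ θ → 0 < M →
        (∀ (v : V) (j : ℕ) (q : ℝ), 1 ≤ j → (q = j ∨ q = (1 + δ.toReal) * j) →
          ϱ v (ENNReal.ofReal q) ^ q ≤ ENNReal.ofReal (M ^ q * Real.Gamma (q + 1) ^ θ)) →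
        ∀ k : ℕ, 2 ≤ k →
          ‖cumulant P (fun ω => ∑ v, X v ω) k‖ ≤
            3 * C ^ (θ / (1 + δ.toReal)) * d ^ k * Fintype.card V * c ^ k *
              (1 + δ.toReal) ^ (θ * k) * M ^ k * (k.factorial : ℝ) ^ (1 + u₀ / η + θ)) := by
  refine ⟨2 * Real.exp 2, by positivity, fun c₀ a u₀ η hc₀ ha hu₀ hη => ?_⟩
  obtain ⟨c, hc, hmain⟩ := exists_norm_cumulant_le c₀ a u₀ η hc₀ ha hu₀ hη
  refine ⟨c, hc, ?_⟩
  intro V _ Ω _ P _ ρ X ϱ δ γ d H hball hd hγ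
  have hbound := hmain V Ω P ρ X ϱ δ γ d H hball hd hγ
  refine ⟨fun k hk => ?_, fun _ hδ => ?_, fun hδ θ M hθ hM hgrow k hk => ?_⟩
  · refine ofReal_le_mul_maxBound_pow_add H.bound_pos (by omega) (by positivity)
      (fun hV => by simp) (fun hV => ?_) _ fun M hM h₁ h₂ => hbound k M (by omega) hM h₁ h₂
    have : (0 : ℝ) < Fintype.card V := by exact_mod_cast Fintype.card_pos
    positivity
  · subst hδ
    have H' := isMixingField_top H
    refine ⟨H', fun k hk => ?_⟩
    have h := ofReal_le_mul_maxBound_pow_add (z := ‖cumulant P (fun ω => ∑ v, X v ω) k‖)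
      (A := d ^ k * Fintype.card V * c ^ k * (k.factorial : ℝ) ^ (1 + u₀ / η))
      H'.bound_pos (by omega : 1 ≤ k) (by positivity)
      (fun hV => by simp)
      (fun hV => by
        have : (0 : ℝ) < Fintype.card V := by exact_mod_cast Fintype.card_pos
        positivity) ((1 + ⊤) * k)
      fun M hM h₁ h₂ => hmain V Ω P ρ X _ ⊤ γ d H' hball hd hγ k M (by omega) hM h₁ h₂
    have hmax : ∀ q, maxBound (fun v _ => ϱ v ⊤) q = maxBound ϱ ⊤ := fun q => rfl
    rw [hmax, hmax, ← two_mul, ← mul_assoc] at h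
    refine h.trans (le_of_eq ?_)
    congr 1
    rw [← ENNReal.ofReal_ofNat 2, ← ENNReal.ofReal_mul (by positivity)]
    congr 1
    ring
  · have hk1 : 1 ≤ k := by omega
    have hk0 : (0 : ℝ) < k := by exact_mod_cast hk1
    set x : ℝ := 1 + δ.toReal with hx
    have hx1 : 1 ≤ x := by
      have : 0 ≤ δ.toReal := ENNReal.toReal_nonneg
      linarith
    have hx0 : 0 < x := by linarith
    have hxk : 0 < x * k := by positivity
    have hfac : (0 : ℝ) < k.factorial := by positivity
    have hΓ : 0 < Real.Gamma (x * k + 1) := Real.Gamma_pos_of_pos (by positivity)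
    have h₁ := maxBound_le_of_rpow_le (ϱ := ϱ) hk0 hM hfac fun v => by
      have := hgrow v k k hk1 (Or.inl rfl)
      rwa [Real.Gamma_nat_eq_factorial] at this
    have h₂ := maxBound_le_of_rpow_le (ϱ := ϱ) hxk hM hΓ fun v =>
      hgrow v k (x * k) hk1 (Or.inr rfl)
    rw [ENNReal.ofReal_natCast] at h₁
    have hq : ENNReal.ofReal (x * k) = (1 + δ) * k := by
      rw [ENNReal.ofReal_mul hx0.le, ENNReal.ofReal_natCast, hx,
        ENNReal.ofReal_add zero_le_one ENNReal.toReal_nonneg, ENNReal.ofReal_one,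
        ENNReal.ofReal_toReal hδ.ne]
    rw [hq] at h₂
    -- the growth condition for `q = k` and `q = x * k` turned into bounds for the norms
    set M₁ : ℝ := M * (k.factorial : ℝ) ^ (θ / k) with hM₁
    set M₂ : ℝ := M * Real.Gamma (x * k + 1) ^ (θ / (x * k)) with hM₂
    have hM₁0 : 0 < M₁ := by positivity
    have hM₂0 : 0 < M₂ := by positivity
    have hb := hbound k (max M₁ M₂) hk1 (lt_max_of_lt_left hM₁0)
      (h₁.trans (ENNReal.ofReal_le_ofReal (le_max_left _ _)))
      (h₂.trans (ENNReal.ofReal_le_ofReal (le_max_right _ _)))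
    have hM₁k : M₁ ^ k = M ^ k * (k.factorial : ℝ) ^ θ := by
      rw [hM₁, mul_pow, ← Real.rpow_natCast ((k.factorial : ℝ) ^ (θ / k)),
        ← Real.rpow_mul hfac.le, div_mul_cancel₀ _ hk0.ne']
    have hM₂k : M₂ ^ k ≤ M ^ k *
        ((2 * Real.exp 2) ^ (θ / x) * x ^ (θ * k) * (k.factorial : ℝ) ^ θ) := by
      have h3 : Real.Gamma (x * k + 1) ^ (θ / x) ≤
          (2 * Real.exp 2) ^ (θ / x) * x ^ (θ * k) * (k.factorial : ℝ) ^ θ := by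
        refine (Real.rpow_le_rpow hΓ.le (Gamma_mul_add_one_le hx1 hk1)
          (by positivity)).trans (le_of_eq ?_)
        rw [Real.mul_rpow (by positivity) (by positivity),
          Real.mul_rpow (by positivity) (by positivity), ← Real.rpow_mul hx0.le,
          ← Real.rpow_mul hfac.le]
        congr 3 <;> field_simp
      rw [hM₂, mul_pow, ← Real.rpow_natCast (Real.Gamma (x * k + 1) ^ (θ / (x * k))),
        ← Real.rpow_mul hΓ.le]
      have h4 : θ / (x * k) * k = θ / x := by field_simp
      rw [h4]
      exact mul_le_mul_of_nonneg_left h3 (by positivity)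
    have hone : 1 ≤ (2 * Real.exp 2) ^ (θ / x) * x ^ (θ * k) := by
      have hE : (1 : ℝ) ≤ Real.exp 2 := Real.one_le_exp (by norm_num)
      exact one_le_mul_of_one_le_of_one_le (Real.one_le_rpow (by linarith) (by positivity))
        (Real.one_le_rpow hx1 (by positivity))
    have hmaxk : max M₁ M₂ ^ k ≤ 3 * ((2 * Real.exp 2) ^ (θ / x) * x ^ (θ * k)) *
        (M ^ k * (k.factorial : ℝ) ^ θ) := by
      have h5 : max M₁ M₂ ^ k ≤ M₁ ^ k + M₂ ^ k := by
        rcases max_choice M₁ M₂ with h | h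
        · rw [h]; linarith [pow_pos hM₂0 k]
        · rw [h]; linarith [pow_pos hM₁0 k]
      rw [hM₁k] at h5
      set Z : ℝ := (2 * Real.exp 2) ^ (θ / x) * x ^ (θ * k) with hZ
      have h6 : 0 < M ^ k * (k.factorial : ℝ) ^ θ := by positivity
      nlinarith
    refine hb.trans ((mul_le_mul_of_nonneg_left hmaxk (by positivity)).trans (le_of_eq ?_))
    rw [Real.rpow_add hfac (1 + u₀ / η) θ]
    ring
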